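/- Let $S$ and $T$ be abelian, cancellative monoids that are torsion-free (i.e. $s_1^i=s_2^i$ with $i\ge 1$ implies $s_1=s_2$), and let $A$ and $B$ be torsion-free abelian groups of finite rank. Let $\sigma\colon S\curvearrowright A$ and $\tau\colon T\curvearrowright B$ be algebraic actions, i.e. monoid homomorphisms $s\mapsto\sigma_s$, $t\mapsto\tau_t$ into the injective endomorphisms of $A$ and $B$. Assume that both actions are faithful (the maps $s\mapsto\sigma_s$ and $t\mapsto\tau_t$ are injective) and non-automorphic (some $\sigma_s$ and some $\tau_t$ are not surjective), and that the dual actions are mixing: with $\mu$ the normalized Haar measure on the compact dual group $\widehat A$ of the discrete group $A$, and $\hat\sigma_s(\chi)=\chi\circ\sigma_s$, $$\lim_{s\to\infty}\mu\bigl(X\cap\hat\sigma_s^{-1}(Y)\bigr)=\mu(X)\mu(Y)\quad\text{for all Borel sets } X,Y\subseteq\widehat A,$$ where $s\to\infty$ means that $s$ leaves every finite subset of $S$; and likewise for $\hat\tau$. Let $\tilde\sigma\colon S^{-1}S\curvearrowright S^{-1}A$ and $\tilde\tau\colon T^{-1}T\curvearrowright T^{-1}B$ be the canonical globalizations, obtained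 by localization. Let $\mathcal C$ be the smallest family of subgroups of $A$ that contains $A$ and is closed under $C\mapsto\sigma_s(C)$ and $C\mapsto\sigma_s^{-1}(C)$ for all $s\in S$, and let $\overline A=\varprojlim_{C\in\mathcal C}A/C$ with the projective limit topology of the discrete quotients. The action $\sigma$ extends to $\overline A$, the group $S^{-1}A\rtimes S^{-1}S$ acts on $S^{-1}\overline A\supseteq\overline A$ by $(z,\gamma).x=z+\gamma.x$ (where $z$ is replaced by its image in $S^{-1}\overline A$), and $$(S^{-1}A\rtimes S^{-1}S)\ltimes\overline A=\{(g,x)\in(S^{-1}A\rtimes S^{-1}S)\times\overline A : g.x\in\overline A\}$$ is the associated partial transformation groupoid: $(g,x)$ has source $x$ and range $g.x$, the product is $(g,h.x)(h,x)=(gh,x)$, and the topology is the subspace topology with $S^{-1}A\rtimes S^{-1}S$ discrete. Define $(T^{-1}B\rtimes T^{-1}T)\ltimes\overline B$ in the same way. If there is an isomorphism of topological groupoids $$(S^{-1}A\rtimes S^{-1}S)\ltimes\overline A\;\cong\;(T^{-1}B\rtimes T^{-1}T)\ltimes\overline B,$$ then $\tilde\sigma$ and $\tilde\tau$ are mutually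 embeddable via finite index embeddings: there are injective group homomorphisms $\mathfrak t\colon S^{-1}S\to T^{-1}T$ and $\mathfrak b\colon S^{-1}A\to T^{-1}B$ with $\mathfrak b(\tilde\sigma_s(x))=\tilde\tau_{\mathfrak t(s)}(\mathfrak b(x))$ for all $s\in S^{-1}S$, $x\in S^{-1}A$, and such that $\mathfrak b(S^{-1}A)$ has finite index in $T^{-1}B$; and there are injective group homomorphisms $\mathfrak s\colon T^{-1}T\to S^{-1}S$ and $\mathfrak a\colon T^{-1}B\to S^{-1}A$ with $\mathfrak a(\tilde\tau_t(y))=\tilde\sigma_{\mathfrak s(t)}(\mathfrak a(y))$ for all $t\in T^{-1}T$, $y\in T^{-1}B$, and such that $\mathfrak a(T^{-1}B)$ has finite index in $S^{-1}A$. -/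

import Mathlib

open Filter Topology MeasureTheory
open scoped OreLocalization

/-! ### Algebraic actions, constructible subgroups and the completion

An algebraic action of a monoid `S` on an abelian group `A` is a `DistribMulAction S A` by
injective endomorphisms (`IsLeftCancelSMul S A`). -/

/-- Not every element of `S` acts by an automorphism of `A`. -/
def IsNonAutomorphic (S A : Type*) [SMul S A] : Prop :=
  ∃ s : S, ¬ Function.Surjective (fun a : A => s • a)

section Completion

variable (S : Type*) (A : Type*) [Monoid S] [AddCommGroup A] [DistribMulAction S A]

/-- The `S`-constructible subgroups of `A`: the smallest family of subgroups containing `A` and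
closed under images and preimages under all elements of `S`. -/
inductive IsConstructible : AddSubgroup A → Prop
  | top : IsConstructible ⊤
  | map (s : S) (C : AddSubgroup A) :
      IsConstructible C → IsConstructible (C.map (DistribSMul.toAddMonoidHom A s))
  | comap (s : S) (C : AddSubgroup A) :
      IsConstructible C → IsConstructible (C.comap (DistribSMul.toAddMonoidHom A s))

/-- The family of constructible subgroups, as a type. -/
abbrev ConstructibleSubgroup : Type _ := {C : AddSubgroup A // IsConstructible S A C}

/-- The coherent families in `∏ A ⧸ C`, with `C` running through the constructible subgroups. -/
def completionSubgroup : AddSubgroup (∀ C : ConstructibleSubgroup S A, A ⧸ C.1) where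
  carrier := {x | ∀ (C D : ConstructibleSubgroup S A) (h : C.1 ≤ D.1),
    QuotientAddGroup.map C.1 D.1 (AddMonoidHom.id A) h (x C) = x D}
  zero_mem' := fun C D h => map_zero _
  add_mem' := fun {x y} hx hy C D h => by
    rw [Pi.add_apply, map_add, hx C D h, hy C D h, Pi.add_apply]
  neg_mem' := fun {x} hx C D h => by
    rw [Pi.neg_apply, map_neg, hx C D h, Pi.neg_apply]

/-- The completion `lim A ⧸ C`, over all constructible subgroups `C`. -/
def Completion : Type _ := completionSubgroup S A

namespace Completion

instance : AddCommGroup (Completion S A) :=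
  inferInstanceAs (AddCommGroup (completionSubgroup S A))

/-- The projective limit topology, the quotients `A ⧸ C` being discrete. -/
instance : TopologicalSpace (Completion S A) :=
  ⨅ C : ConstructibleSubgroup S A, TopologicalSpace.induced (fun x : Completion S A => x.1 C) ⊥

variable {S A}

@[ext]
theorem ext {x y : Completion S A} (h : ∀ C, x.1 C = y.1 C) : x = y :=
  Subtype.ext (funext h)

theorem add_val (x y : Completion S A) (C) : (x + y).1 C = x.1 C + y.1 C := rfl

theorem zero_val (C) : (0 : Completion S A).1 C = 0 := rfl

theorem val_of_le (x : Completion S A) {C D : ConstructibleSubgroup S A} (h : C.1 ≤ D.1) {a : A}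
    (ha : x.1 C = QuotientAddGroup.mk a) : x.1 D = QuotientAddGroup.mk a := by
  rw [← x.2 C D h, ha]
  rfl

/-- The preimage of a constructible subgroup under `s`. -/
def pre (s : S) (C : ConstructibleSubgroup S A) : ConstructibleSubgroup S A :=
  ⟨C.1.comap (DistribSMul.toAddMonoidHom A s), .comap s C.1 C.2⟩

/-- The map `A ⧸ s⁻¹C → A ⧸ C` induced by `s`. -/
def quotMap (s : S) (C : ConstructibleSubgroup S A) : A ⧸ (pre s C).1 →+ A ⧸ C.1 :=
  QuotientAddGroup.map (pre s C).1 C.1 (DistribSMul.toAddMonoidHom A s) le_rfl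

theorem quotMap_mk (s : S) (C : ConstructibleSubgroup S A) (a : A) :
    quotMap s C (QuotientAddGroup.mk a) = QuotientAddGroup.mk (s • a) := rfl

/-- The action of `S` on the completion extending that on `A`. -/
instance : SMul S (Completion S A) where
  smul s x := ⟨fun C => quotMap s C (x.1 (pre s C)), fun C D h => by
    obtain ⟨a, ha⟩ := QuotientAddGroup.mk_surjective (x.1 (pre s C))
    have hD := x.val_of_le (D := pre s D) (AddSubgroup.comap_mono h) ha.symm
    exact (congrArg (fun q => QuotientAddGroup.map C.1 D.1 (AddMonoidHom.id A) h (quotMap s C q))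
      ha.symm).trans (congrArg (quotMap s D) hD.symm)⟩

theorem smul_val (s : S) (x : Completion S A) (C) : (s • x).1 C = quotMap s C (x.1 (pre s C)) :=
  rfl

instance : DistribMulAction S (Completion S A) where
  one_smul x := by
    ext C
    obtain ⟨a, ha⟩ := QuotientAddGroup.mk_surjective (x.1 (pre 1 C))
    have hle : (pre (1 : S) C).1 ≤ C.1 := fun b hb => by
      have hb' : (1 : S) • b ∈ C.1 := hb
      rwa [one_smul] at hb'
    rw [smul_val, x.val_of_le hle ha.symm, ← ha, quotMap_mk, one_smul]
  mul_smul s t x := by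
    ext C
    obtain ⟨a, ha⟩ := QuotientAddGroup.mk_surjective (x.1 (pre (s * t) C))
    have hle : (pre (s * t) C).1 ≤ (pre t (pre s C)).1 := fun b hb => by
      have hb' : (s * t) • b ∈ C.1 := hb
      rw [mul_smul] at hb'
      exact hb'
    rw [smul_val, smul_val, smul_val, x.val_of_le hle ha.symm, ← ha, quotMap_mk, quotMap_mk,
      quotMap_mk, mul_smul]
  smul_zero s := by
    ext C
    rw [smul_val, zero_val, zero_val, map_zero]
  smul_add s x y := by
    ext C
    rw [smul_val, add_val, map_add, add_val, smul_val, smul_val]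

variable (S A) in
/-- The canonical homomorphism from `A` to its completion. -/
def of : A →+ Completion S A where
  toFun a := ⟨fun _ => QuotientAddGroup.mk a, fun _ _ _ => rfl⟩
  map_zero' := rfl
  map_add' _ _ := rfl

theorem of_smul (s : S) (a : A) : of S A (s • a) = s • of S A a := rfl

/-- The image of a constructible subgroup under `s`. -/
def img (s : S) (C : ConstructibleSubgroup S A) : ConstructibleSubgroup S A :=
  ⟨C.1.map (DistribSMul.toAddMonoidHom A s), .map s C.1 C.2⟩

theorem val_eq_of_smul [IsLeftCancelSMul S A] (s : S) {x y : Completion S A}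
    (C : ConstructibleSubgroup S A) (h : (s • x).1 (img s C) = (s • y).1 (img s C)) :
    x.1 C = y.1 C := by
  obtain ⟨a, ha⟩ := QuotientAddGroup.mk_surjective (x.1 (pre s (img s C)))
  obtain ⟨b, hb⟩ := QuotientAddGroup.mk_surjective (y.1 (pre s (img s C)))
  have hle : (pre s (img s C)).1 ≤ C.1 := by
    rintro c ⟨d, hd, hdc⟩
    have hdc' : s • d = s • c := hdc
    rwa [← IsLeftCancelSMul.left_cancel s d c hdc']
  rw [smul_val, smul_val, ← ha, ← hb, quotMap_mk, quotMap_mk, QuotientAddGroup.eq,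
    ← smul_neg, ← smul_add] at h
  rw [x.val_of_le hle ha.symm, y.val_of_le hle hb.symm, QuotientAddGroup.eq]
  exact hle h

theorem eq_of_smul_eq [IsLeftCancelSMul S A] (s : S) {x y : Completion S A}
    (h : s • x = s • y) : x = y :=
  ext fun C => val_eq_of_smul s C (by rw [h])

theorem continuous_iff {Z : Type*} [TopologicalSpace Z] {f : Z → Completion S A} :
    Continuous f ↔ ∀ C (q : A ⧸ C.1), IsOpen {z | (f z).1 C = q} := by
  rw [continuous_iInf_rng]
  refine forall_congr' fun C => ?_
  rw [continuous_induced_rng]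
  let _ : TopologicalSpace (A ⧸ C.1) := ⊥
  have : DiscreteTopology (A ⧸ C.1) := ⟨rfl⟩
  exact continuous_discrete_rng

theorem isOpen_coord (C : ConstructibleSubgroup S A) (U : Set (A ⧸ C.1)) :
    IsOpen {x : Completion S A | x.1 C ∈ U} :=
  (iInf_le (fun C : ConstructibleSubgroup S A =>
    TopologicalSpace.induced (fun x : Completion S A => x.1 C) ⊥) C) _ ⟨U, trivial, rfl⟩

end Completion

end Completion

/-! ### The canonical globalization and the enveloping action -/

section Globalization

variable (S : Type*) (A : Type*) [CommMonoid S] [AddCommGroup A] [DistribMulAction S A]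

/-- The group of fractions `S⁻¹S`. -/
abbrev FracGroup (S : Type*) [CommMonoid S] : Type _ := Algebra.GrothendieckGroup S

/-- The localization `S⁻¹A`, whose elements are the fractions `a /ₒ s`. It carries the action
`(t /ₒ s) • (a /ₒ r) = (t • a) /ₒ (r * s)` of `S⁻¹S`, which is the canonical globalization. -/
abbrev FracModule : Type _ := OreLocalization (⊤ : Submonoid S) A

/-- The homomorphism `S⁻¹A → S⁻¹Ā` induced by the canonical homomorphism from `A` to its
completion `Ā`. -/
noncomputable def fracOf : FracModule S A →+ FracModule S (Completion S A) where
  toFun := OreLocalization.liftExpand (fun a s => Completion.of S A a /ₒ s) fun a t s ht => by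
    rw [Completion.of_smul]
    exact OreLocalization.expand _ s t ht
  map_zero' := by
    rw [OreLocalization.zero_def, OreLocalization.liftExpand_of, map_zero,
      OreLocalization.zero_oreDiv]
  map_add' x y := by
    induction x using OreLocalization.ind with | _ a s
    induction y using OreLocalization.ind with | _ b t
    have h : ((t : (⊤ : Submonoid S)) : S) * s = (s : S) * t := mul_comm _ _
    rw [OreLocalization.oreDiv_add_char s t (s : S) t h, OreLocalization.liftExpand_of,
      OreLocalization.liftExpand_of, OreLocalization.liftExpand_of,
      OreLocalization.oreDiv_add_char s t (s : S) t h, map_add]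
    rfl

theorem fracOf_oreDiv (a : A) (s : (⊤ : Submonoid S)) :
    fracOf S A (a /ₒ s) = Completion.of S A a /ₒ s := rfl

theorem fracOf_smul (g : FracGroup S) (x : FracModule S A) :
    fracOf S A (g • x) = g • fracOf S A x := by
  induction x using OreLocalization.ind with | _ a s
  induction g using OreLocalization.ind with | _ t r
  rw [OreLocalization.oreDiv_smul_char t a r s t s (mul_comm _ _), fracOf_oreDiv, fracOf_oreDiv,
    OreLocalization.oreDiv_smul_char t _ r s t s (mul_comm _ _), Completion.of_smul]

/-- The action of `S⁻¹S` on `S⁻¹A` by automorphisms (with `S⁻¹A` written multiplicatively). -/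
noncomputable def globalizationHom : FracGroup S →* MulAut (Multiplicative (FracModule S A)) where
  toFun g := AddEquiv.toMultiplicative (DistribMulAction.toAddEquiv (FracModule S A) g)
  map_one' := by
    ext x
    exact congrArg Multiplicative.ofAdd (one_smul (FracGroup S) x.toAdd)
  map_mul' g h := by
    ext x
    exact congrArg Multiplicative.ofAdd (mul_smul g h x.toAdd)

/-- The semidirect product `S⁻¹A ⋊ S⁻¹S`. -/
abbrev AffineGroup : Type _ := Multiplicative (FracModule S A) ⋊[globalizationHom S A] FracGroup S

/-- The enveloping action of `S⁻¹A ⋊ S⁻¹S` on `S⁻¹Ā` by affine maps `x ↦ z + γ • x`. -/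
noncomputable instance : MulAction (AffineGroup S A) (FracModule S (Completion S A)) where
  smul g x := fracOf S A g.left.toAdd + g.right • x
  one_smul x := by
    change fracOf S A 0 + (1 : FracGroup S) • x = x
    rw [map_zero, zero_add, one_smul]
  mul_smul g h x := by
    change fracOf S A (g.left.toAdd + g.right • h.left.toAdd) + (g.right * h.right) • x =
      fracOf S A g.left.toAdd + g.right • (fracOf S A h.left.toAdd + h.right • x)
    rw [map_add, fracOf_smul, mul_smul, smul_add, add_assoc]

theorem affineGroup_smul_def (g : AffineGroup S A) (x : FracModule S (Completion S A)) :
    g • x = fracOf S A g.left.toAdd + g.right • x := rfl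

end Globalization

/-! ### Topological groupoids -/

/-- A topological groupoid (a small category in which every arrow is invertible, with continuous
structure maps). Products are written as for maps: `mul a b` means "first `b`, then `a`". -/
structure TopGroupoid.{u, v} where
  Obj : Type u
  Arr : Type v
  [topObj : TopologicalSpace Obj]
  [topArr : TopologicalSpace Arr]
  source : Arr → Obj
  range : Arr → Obj
  unit : Obj → Arr
  inv : Arr → Arr
  mul : ∀ a b : Arr, source a = range b → Arr
  source_unit : ∀ x, source (unit x) = x
  range_unit : ∀ x, range (unit x) = x
  source_inv : ∀ a, source (inv a) = range a
  range_inv : ∀ a, range (inv a) = source a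
  source_mul : ∀ a b h, source (mul a b h) = source b
  range_mul : ∀ a b h, range (mul a b h) = range a
  mul_unit : ∀ a, mul a (unit (source a)) (range_unit _).symm = a
  unit_mul : ∀ a, mul (unit (range a)) a (source_unit _) = a
  mul_assoc : ∀ a b c hab hbc, mul (mul a b hab) c ((source_mul a b hab).trans hbc) =
    mul a (mul b c hbc) (hab.trans (range_mul b c hbc).symm)
  inv_mul : ∀ a, mul (inv a) a (source_inv a) = unit (source a)
  mul_inv : ∀ a, mul a (inv a) (range_inv a).symm = unit (range a)
  continuous_source : Continuous source
  continuous_range : Continuous range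
  continuous_unit : Continuous unit
  continuous_inv : Continuous inv
  continuous_mul : Continuous fun p : {p : Arr × Arr // source p.1 = range p.2} =>
    mul p.1.1 p.1.2 p.2

attribute [instance] TopGroupoid.topObj TopGroupoid.topArr

/-- An isomorphism of topological groupoids. -/
structure TopGroupoid.Iso.{u, v, u', v'} (G : TopGroupoid.{u, v}) (H : TopGroupoid.{u', v'}) where
  obj : G.Obj ≃ₜ H.Obj
  arr : G.Arr ≃ₜ H.Arr
  source_arr : ∀ a, H.source (arr a) = obj (G.source a)
  range_arr : ∀ a, H.range (arr a) = obj (G.range a)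
  arr_mul : ∀ a b (h : G.source a = G.range b), arr (G.mul a b h) =
    H.mul (arr a) (arr b) ((source_arr a).trans ((congrArg obj h).trans (range_arr b).symm))

/-! ### The groupoid of an algebraic action -/

section ActionGroupoid

variable (S : Type*) (A : Type*) [CommMonoid S] [AddCommGroup A] [DistribMulAction S A]

/-- The canonical map from the completion `Ā` to `S⁻¹Ā`. -/
def toFrac (x : Completion S A) : FracModule S (Completion S A) := x /ₒ 1

theorem toFrac_injective [IsLeftCancelSMul S A] : Function.Injective (toFrac S A) := by
  intro x y h
  obtain ⟨u, v, h1, h2⟩ := OreLocalization.oreDiv_eq_iff.1 h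
  have h3 : (u : S) = v := by simpa using h2
  have h4 : (u : S) • y = v • x := h1
  rw [← h3] at h4
  exact (Completion.eq_of_smul_eq _ h4).symm

/-- The arrows of the partial transformation groupoid: pairs `(g, x)` with `x` in the completion
`Ā` such that `g.x`, computed in `S⁻¹Ā`, lies in `Ā`. -/
def ActionArrow : Type _ :=
  {p : AffineGroup S A × Completion S A //
    ∃ y : Completion S A, p.1 • toFrac S A p.2 = toFrac S A y}

variable {S A}

namespace ActionArrow

/-- The point `g.x` of the completion. -/
noncomputable def target (a : ActionArrow S A) : Completion S A := a.2.choose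

theorem smul_eq (a : ActionArrow S A) : a.1.1 • toFrac S A a.1.2 = toFrac S A a.target :=
  a.2.choose_spec

theorem target_eq [IsLeftCancelSMul S A] (a : ActionArrow S A) {y : Completion S A}
    (h : a.1.1 • toFrac S A a.1.2 = toFrac S A y) : a.target = y :=
  toFrac_injective S A (a.smul_eq.symm.trans h)

/-- The subspace topology from the product of the discrete group `S⁻¹A ⋊ S⁻¹S` and `Ā`. -/
instance : TopologicalSpace (ActionArrow S A) :=
  letI : TopologicalSpace (AffineGroup S A) := ⊥
  instTopologicalSpaceSubtype

theorem continuous_iff {Z : Type*} [TopologicalSpace Z] {f : Z → ActionArrow S A} :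
    Continuous f ↔ IsLocallyConstant (fun z => (f z).1.1) ∧ Continuous fun z => (f z).1.2 := by
  let _ : TopologicalSpace (AffineGroup S A) := ⊥
  have : DiscreteTopology (AffineGroup S A) := ⟨rfl⟩
  have h1 : Continuous f ↔ Continuous fun z => (f z).1 := continuous_induced_rng
  rw [h1, IsLocallyConstant.iff_continuous]
  exact continuous_prodMk

theorem isLocallyConstant_fst : IsLocallyConstant fun a : ActionArrow S A => a.1.1 :=
  (continuous_iff.1 continuous_id).1

theorem continuous_point : Continuous fun a : ActionArrow S A => a.1.2 :=
  (continuous_iff.1 continuous_id).2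

theorem smul_target_eq [IsLeftCancelSMul S A] (a : ActionArrow S A) {b : A} {t : S}
    {r s : (⊤ : Submonoid S)} (hl : a.1.1.left.toAdd = b /ₒ r) (hr : a.1.1.right = t /ₒ s) :
    ((s * r : (⊤ : Submonoid S)) : S) • a.target =
      (s : S) • Completion.of S A b + ((r : S) * t) • a.1.2 := by
  have h := a.smul_eq
  have hc : ((s : (⊤ : Submonoid S)) : S) * r = (r : S) * s := mul_comm _ _
  rw [affineGroup_smul_def, hl, hr, fracOf_oreDiv, toFrac, OreLocalization.smul_div_one,
    OreLocalization.oreDiv_add_char r s (r : S) s hc, toFrac] at h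
  obtain ⟨u, v, h1, h2⟩ := OreLocalization.oreDiv_eq_iff.1 h
  have h3 : (u : S) = v * ((s * r : (⊤ : Submonoid S)) : S) := by simpa using h2
  have h4 : (u : S) • a.target = v • ((s : S) • Completion.of S A b + (r : S) • t • a.1.2) := h1
  rw [h3, mul_smul] at h4
  rw [mul_smul (r : S) t]
  exact Completion.eq_of_smul_eq v h4

theorem continuous_target [IsLeftCancelSMul S A] :
    Continuous fun a : ActionArrow S A => a.target := by
  refine Completion.continuous_iff.2 fun C q => isOpen_iff_forall_mem_open.2 fun a ha => ?_
  obtain ⟨b, r, hl⟩ : ∃ b r, a.1.1.left.toAdd = (b /ₒ r : FracModule S A) := by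
    induction a.1.1.left.toAdd using OreLocalization.ind with | _ b r
    exact ⟨b, r, rfl⟩
  obtain ⟨t, s, hr⟩ : ∃ t s, a.1.1.right = (t /ₒ s : FracGroup S) := by
    induction a.1.1.right using OreLocalization.ind with | _ t s
    exact ⟨t, s, rfl⟩
  let k : S := ((s * r : (⊤ : Submonoid S)) : S)
  let D := Completion.img k C
  let E := Completion.pre ((r : S) * t) D
  refine ⟨{a' | a'.1.1 = a.1.1} ∩ {a' | a'.1.2.1 E ∈ ({a.1.2.1 E} : Set _)}, ?_,
    (isLocallyConstant_fst.isOpen_fiber a.1.1).inter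
      ((Completion.isOpen_coord E {a.1.2.1 E}).preimage continuous_point), rfl, rfl⟩
  rintro a' ⟨h1, h2⟩
  have h1' : a'.1.1 = a.1.1 := h1
  have h2' : a'.1.2.1 E = a.1.2.1 E := h2
  refine Eq.trans (Completion.val_eq_of_smul k C ?_) ha
  rw [a'.smul_target_eq (h1' ▸ hl) (h1' ▸ hr), a.smul_target_eq hl hr, Completion.add_val,
    Completion.add_val]
  exact congrArg _ (congrArg (Completion.quotMap ((r : S) * t) D) h2')

end ActionArrow

variable (S A) in
/-- The partial transformation groupoid `(S⁻¹A ⋊ S⁻¹S) ⋉ Ā` of an algebraic action. -/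
noncomputable def actionGroupoid [IsLeftCancelSMul S A] : TopGroupoid where
  Obj := Completion S A
  Arr := ActionArrow S A
  source a := a.1.2
  range a := a.target
  unit x := ⟨(1, x), x, one_smul _ _⟩
  inv a := ⟨(a.1.1⁻¹, a.target), a.1.2, by
    rw [← a.smul_eq, inv_smul_smul]⟩
  mul a b h := ⟨(a.1.1 * b.1.1, b.1.2), a.target, by
    rw [mul_smul, b.smul_eq, ← h, a.smul_eq]⟩
  source_unit _ := rfl
  range_unit x := ActionArrow.target_eq _ (one_smul _ _)
  source_inv _ := rfl
  range_inv a := ActionArrow.target_eq _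
    ((congrArg (a.1.1⁻¹ • ·) a.smul_eq.symm).trans (inv_smul_smul _ _))
  source_mul _ _ _ := rfl
  range_mul a b h := ActionArrow.target_eq _ (by rw [mul_smul, b.smul_eq, ← h, a.smul_eq])
  mul_unit a := Subtype.ext (Prod.ext (mul_one _) rfl)
  unit_mul a := Subtype.ext (Prod.ext (one_mul _) rfl)
  mul_assoc a b c hab hbc := Subtype.ext (Prod.ext (mul_assoc _ _ _) rfl)
  inv_mul a := Subtype.ext (Prod.ext (inv_mul_cancel _) rfl)
  mul_inv a := Subtype.ext (Prod.ext (mul_inv_cancel _) rfl)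
  continuous_source := ActionArrow.continuous_point
  continuous_range := ActionArrow.continuous_target
  continuous_unit := ActionArrow.continuous_iff.2 ⟨IsLocallyConstant.const _, continuous_id⟩
  continuous_inv := ActionArrow.continuous_iff.2
    ⟨ActionArrow.isLocallyConstant_fst.comp (·⁻¹), ActionArrow.continuous_target⟩
  continuous_mul := by
    have h1 : Continuous fun p : {p : ActionArrow S A × ActionArrow S A //
        p.1.1.2 = p.2.target} => p.1.1 := continuous_fst.comp continuous_subtype_val
    have h2 : Continuous fun p : {p : ActionArrow S A × ActionArrow S A //
        p.1.1.2 = p.2.target} => p.1.2 := continuous_snd.comp continuous_subtype_val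
    exact ActionArrow.continuous_iff.2
      ⟨(ActionArrow.isLocallyConstant_fst.comp_continuous h1).comp₂
        (ActionArrow.isLocallyConstant_fst.comp_continuous h2) (· * ·),
        (ActionArrow.continuous_point.comp h2 :)⟩

end ActionGroupoid

/-! ### Mixing of the dual action -/

section Dual

/-- The abelian group `A`, written multiplicatively and equipped with the discrete topology. -/
def DiscreteCopy (A : Type*) : Type _ := Multiplicative A

instance (A : Type*) [AddCommGroup A] : CommGroup (DiscreteCopy A) :=
  inferInstanceAs (CommGroup (Multiplicative A))

instance (A : Type*) : TopologicalSpace (DiscreteCopy A) := ⊥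

instance (A : Type*) : DiscreteTopology (DiscreteCopy A) := ⟨rfl⟩

/-- The compact dual group of the discrete abelian group `A`, consisting of all characters of `A`
with values in the circle. -/
abbrev DiscreteDual (A : Type*) [AddCommGroup A] : Type _ := PontryaginDual (DiscreteCopy A)

namespace DiscreteDual

variable (A : Type*) [AddCommGroup A]

noncomputable instance : MeasurableSpace (DiscreteDual A) := borel _

instance : BorelSpace (DiscreteDual A) := ⟨rfl⟩

/-- The normalized Haar measure on the dual group. -/
noncomputable def haar : Measure (DiscreteDual A) := Measure.haarMeasure ⊤

variable {A}

/-- The dual `χ ↦ χ ∘ φ` of an endomorphism `φ` of `A`. -/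
noncomputable def map (φ : A →+ A) : DiscreteDual A → DiscreteDual A :=
  PontryaginDual.map (A := DiscreteCopy A) (B := DiscreteCopy A)
    { toMonoidHom := (AddMonoidHom.toMultiplicative φ : Multiplicative A →* Multiplicative A)
      continuous_toFun := continuous_of_discreteTopology }

end DiscreteDual

/-- The dual action of `S` on the dual of `A` is (strongly) mixing for the normalized Haar measure
`μ`: `μ(X ∩ s⁻¹Y) → μ(X) μ(Y)` as `s` leaves every finite subset of `S`. -/
def IsDualMixing (S A : Type*) [Monoid S] [AddCommGroup A] [DistribMulAction S A] : Prop :=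
  ∀ X Y : Set (DiscreteDual A), MeasurableSet X → MeasurableSet Y →
    Tendsto (fun s : S => DiscreteDual.haar A
      (X ∩ DiscreteDual.map (DistribSMul.toAddMonoidHom A s) ⁻¹' Y)) cofinite
      (𝓝 (DiscreteDual.haar A X * DiscreteDual.haar A Y))

end Dual

/-! ### Embeddings of actions of groups -/

/-- There is a finite index embedding of `G ↷ M` into `H ↷ N`. -/
def FiniteIndexEmbeddable (G M H N : Type*) [Group G] [AddCommGroup M] [DistribMulAction G M]
    [Group H] [AddCommGroup N] [DistribMulAction H N] : Prop :=
  ∃ (t : G →* H) (b : M →+ N), Function.Injective t ∧ Function.Injective b ∧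
    (∀ (g : G) (x : M), b (g • x) = t g • b x) ∧ b.range.FiniteIndex

/-! ### Torsion-free abelian groups of finite rank -/

section FiniteRank

variable {A : Type*} [AddCommGroup A] [IsAddTorsionFree A]

/-! The group component of the image of an arrow is a locally constant cocycle on the first
groupoid, with values in `T⁻¹B ⋊ T⁻¹T`. Its values on translations by `A` and scalings by `S`, at
base points in `A`, form an `AffineCocycle`. In finite rank an injective endomorphism has image of
finite index (`finiteIndex_range_of_injective`). Hence `Ā` is compact, and a locally constant
function on it is invariant under translation by some `τA`. Consequently the value of the cocycle at
base point `0` is additive on those `a ∈ τA` whose cocycle has period `τ`, and scaling by `s` acts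
on these values by conjugation once `τ` is also a period for `s`.

Mixing forces every `s ≠ 1` to act without nonzero fixed points, so `(s - 1)A` has finite index. A
suitable multiple of any `a` therefore has a commutator as its value, and this lies in `T⁻¹B`
because `T⁻¹T` is abelian. It remains to divide by the multiple inside `T⁻¹B`, which need not be
divisible. The elements `a` for which this is possible form a subgroup that is saturated under `S`
and contains `τA ∩ ⟨F⟩`, with `τ` depending on `F`, for every finite set `F`; `eq_top_of_saturated`
shows that such a subgroup is all of `A`. The result is an equivariant injection `A → T⁻¹B`
(`exists_equivariant_embedding`), which extends to `S⁻¹A`.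

The inverse isomorphism gives an injection the other way. The composite of the two is an injective
endomorphism of a torsion-free group of finite rank, so both images have finite index. -/

theorem finiteIndex_range_nsmul (hr : Module.rank ℤ A < Cardinal.aleph0) {n : ℕ} (hn : n ≠ 0) :
    (nsmulAddMonoidHom (α := A) n).range.FiniteIndex := by
  by_contra h
  rw [AddSubgroup.finiteIndex_iff_finite_quotient, not_finite_iff_infinite] at h
  obtain ⟨r, hr'⟩ := Cardinal.lt_aleph0.1 hr
  -- One class too many: lifts of these classes span a free group `X` of rank at most `r`, so `X /
  -- nX` has at most `n ^ r` elements, yet classes distinct modulo `nA` stay distinct modulo `nX`.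
  obtain ⟨s, hs⟩ := Infinite.exists_subset_card_eq (A ⧸ (nsmulAddMonoidHom (α := A) n).range)
    (n ^ r + 1)
  let X : Submodule ℤ A := Submodule.span ℤ (Function.surjInv QuotientAddGroup.mk_surjective ''
    (s : Set (A ⧸ (nsmulAddMonoidHom (α := A) n).range)))
  have hfg : X.FG := Submodule.fg_span (s.finite_toSet.image _)
  have : Module.Finite ℤ X := Module.Finite.iff_fg.2 hfg
  have : Module.Free ℤ X := Module.free_iff_isTorsionFree.2 inferInstance
  have hrk : Module.finrank ℤ X ≤ r := by
    have := Submodule.rank_le X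
    rw [hr', ← Module.finrank_eq_rank] at this
    exact_mod_cast this
  have hidx := AddSubgroup.index_range_nsmul (M := X) n
  have hpos : (nsmulAddMonoidHom (α := X) n).range.index ≠ 0 := by
    rw [hidx]; positivity
  have : Finite (X ⧸ (nsmulAddMonoidHom (α := X) n).range) :=
    AddSubgroup.finiteIndex_iff_finite_quotient.1 ⟨hpos⟩
  let f : s → X ⧸ (nsmulAddMonoidHom (α := X) n).range := fun q =>
    QuotientAddGroup.mk ⟨Function.surjInv QuotientAddGroup.mk_surjective q.1,
      Submodule.subset_span ⟨q.1, q.2, rfl⟩⟩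
  have hf : Function.Injective f := by
    intro p q hpq
    obtain ⟨y, hy⟩ := QuotientAddGroup.eq.1 hpq
    refine Subtype.ext ?_
    rw [← Function.surjInv_eq QuotientAddGroup.mk_surjective p.1,
      ← Function.surjInv_eq QuotientAddGroup.mk_surjective q.1]
    exact QuotientAddGroup.eq.2 ⟨y, congrArg Subtype.val hy⟩
  have hc := Nat.card_le_card_of_injective f hf
  rw [← AddSubgroup.index_eq_card, hidx, Nat.card_eq_fintype_card, Fintype.card_coe, hs] at hc
  have := Nat.pow_le_pow_right (Nat.pos_of_ne_zero hn) hrk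
  omega

omit [IsAddTorsionFree A] in
theorem exists_aeval_apply_eq_zero (hr : Module.rank ℤ A < Cardinal.aleph0)
    (φ : Module.End ℤ A) (a : A) :
    ∃ P : Polynomial ℤ, P ≠ 0 ∧ Polynomial.aeval φ P a = 0 := by
  by_contra! h
  let ψ : Polynomial ℤ →ₗ[ℤ] A :=
    (LinearMap.applyₗ a).comp (Polynomial.aeval (R := ℤ) φ).toLinearMap
  have hψ : LinearMap.ker ψ = ⊥ := (LinearMap.ker_eq_bot').2 fun P hP => by
    by_contra hne
    exact h P hne hP
  have hli := (Polynomial.basisMonomials ℤ).linearIndependent.map' ψ hψ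
  have := hli.aleph0_le_rank
  exact absurd hr this.not_gt

/-- The product of annihilating polynomials for a maximal independent set kills its span; the
quotient by the span is torsion and `A` is torsion-free, so it kills `A`. -/
theorem exists_aeval_eq_zero (hr : Module.rank ℤ A < Cardinal.aleph0) (φ : Module.End ℤ A) :
    ∃ P : Polynomial ℤ, P ≠ 0 ∧ Polynomial.aeval φ P = 0 := by
  classical
  obtain ⟨s, hs, hli⟩ := exists_set_linearIndependent_of_isDomain ℤ A
  have hfin : s.Finite := by rwa [← Cardinal.lt_aleph0_iff_set_finite, hs]
  have hX : Module.rank ℤ (Submodule.span ℤ s) = Module.rank ℤ A := by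
    rw [← hs]; exact rank_span_set hli
  have h0 : Module.rank ℤ (A ⧸ Submodule.span ℤ s) = 0 := by
    have h := rank_quotient_add_rank_of_isDomain (R := ℤ) (Submodule.span ℤ s)
    rw [hX] at h
    obtain ⟨r, hr'⟩ := Cardinal.lt_aleph0.1 hr
    have hlt := (rank_quotient_le (Submodule.span ℤ s)).trans_lt hr
    obtain ⟨q, hq⟩ := Cardinal.lt_aleph0.1 hlt
    rw [hr', hq] at h
    rw [hq]
    have : q + r = r := by exact_mod_cast h
    have : q = 0 := by omega
    exact_mod_cast this
  choose P hP0 hP using exists_aeval_apply_eq_zero hr φ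
  refine ⟨∏ a ∈ hfin.toFinset, P a, Finset.prod_ne_zero_iff.2 fun a _ => hP0 a, ?_⟩
  have hspan : Submodule.span ℤ s ≤
      LinearMap.ker (Polynomial.aeval φ (∏ a ∈ hfin.toFinset, P a)) := by
    refine Submodule.span_le.2 fun a ha => ?_
    rw [SetLike.mem_coe, LinearMap.mem_ker,
      ← Finset.prod_erase_mul _ _ (hfin.mem_toFinset.2 ha), map_mul, Module.End.mul_apply, hP,
      map_zero]
  ext a
  obtain ⟨m, hm, h⟩ := rank_eq_zero_iff.1 h0 (Submodule.Quotient.mk a)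
  rw [← Submodule.Quotient.mk_smul, Submodule.Quotient.mk_eq_zero] at h
  have h1 := hspan h
  rw [LinearMap.mem_ker, map_smul] at h1
  exact (smul_eq_zero.1 h1).resolve_left hm

/-- Injectivity allows powers of `X` to be cancelled from an annihilating polynomial, leaving `Q`
with `Q(0) ≠ 0` and `Q(φ) = 0`. Then `Q(0)A ⊆ φ(A)`, and `Q(0)A` has finite index. -/
theorem finiteIndex_range_of_injective (hr : Module.rank ℤ A < Cardinal.aleph0) (φ : A →+ A)
    (hφ : Function.Injective φ) : φ.range.FiniteIndex := by
  obtain ⟨P, hP0, hP⟩ := exists_aeval_eq_zero hr φ.toIntLinearMap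
  obtain ⟨Q, hPQ, hQ⟩ := Polynomial.exists_eq_pow_rootMultiplicity_mul_and_not_dvd P hP0 0
  rw [map_zero, sub_zero] at hPQ hQ
  rw [hPQ, map_mul, map_pow, Polynomial.aeval_X] at hP
  have hpow : Function.Injective (φ.toIntLinearMap ^ Polynomial.rootMultiplicity 0 P) := by
    rw [Module.End.coe_pow]
    exact Function.Injective.iterate hφ _
  have hQ0 : Polynomial.aeval φ.toIntLinearMap Q = 0 := by
    ext a
    refine hpow ?_
    rw [← Module.End.mul_apply, hP, LinearMap.zero_apply]
    exact (map_zero _).symm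
  have hc : (Q.coeff 0).natAbs ≠ 0 := by
    rw [Int.natAbs_ne_zero]
    exact fun h => hQ (Polynomial.X_dvd_iff.2 h)
  have := finiteIndex_range_nsmul hr hc
  suffices hle : (nsmulAddMonoidHom (α := A) (Q.coeff 0).natAbs).range ≤ φ.range from
    AddSubgroup.finiteIndex_of_le hle
  rintro _ ⟨a, rfl⟩
  have h1 : Q.coeff 0 • a ∈ φ.range := by
    have h2 := congrArg (fun ψ : Module.End ℤ A => ψ a) hQ0
    rw [← Polynomial.X_mul_divX_add Q] at h2
    simp only [map_add, map_mul, Polynomial.aeval_X, Polynomial.aeval_C, LinearMap.add_apply,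
      Module.End.mul_apply, LinearMap.zero_apply, Module.algebraMap_end_apply] at h2
    rw [eq_neg_of_add_eq_zero_right h2]
    exact neg_mem ⟨_, rfl⟩
  rw [nsmulAddMonoidHom_apply, ← natCast_zsmul, Int.natCast_natAbs]
  rcases abs_choice (Q.coeff 0) with h | h <;> rw [h]
  · exact h1
  · rw [neg_smul]; exact neg_mem h1

end FiniteRank

/-! ### Saturated subgroups of algebraic actions -/

section Saturated

theorem AddSubgroup.mem_of_coprime_nsmul_mem {A : Type*} [AddCommGroup A] (H : AddSubgroup A)
    {m n : ℕ} (h : m.Coprime n) {a : A} (hm : m • a ∈ H) (hn : n • a ∈ H) : a ∈ H := by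
  have h1 := Nat.gcd_eq_gcd_ab m n
  rw [h.gcd_eq_one] at h1
  have h2 : a = (m.gcdA n) • (m • a) + (m.gcdB n) • (n • a) := by
    rw [← natCast_zsmul, ← natCast_zsmul, smul_smul, smul_smul, ← add_smul, mul_comm,
      mul_comm (m.gcdB n), ← h1, Nat.cast_one, one_smul]
  rw [h2]
  exact add_mem (zsmul_mem hm _) (zsmul_mem hn _)

variable {S A : Type*} [CommMonoid S] [AddCommGroup A] [IsAddTorsionFree A]
  [DistribMulAction S A] [IsLeftCancelSMul S A]

theorem finiteIndex_range_smul (hr : Module.rank ℤ A < Cardinal.aleph0) (s : S) :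
    (DistribSMul.toAddMonoidHom A s).range.FiniteIndex :=
  finiteIndex_range_of_injective hr _ fun a b h => IsLeftCancelSMul.left_cancel s a b h

omit [IsAddTorsionFree A] [IsLeftCancelSMul S A] in
-- Saturation makes `s` injective on the finite group `A / A₀`, hence surjective.
theorem sup_range_smul_eq_top (A₀ : AddSubgroup A) [A₀.FiniteIndex]
    (hsat : ∀ (s : S) (a : A), s • a ∈ A₀ ↔ a ∈ A₀) (s : S) (a : A) :
    ∃ a₀ ∈ A₀, ∃ b : A, a = a₀ + s • b := by
  have : Finite (A ⧸ A₀) := AddSubgroup.finiteIndex_iff_finite_quotient.1 inferInstance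
  let f : A ⧸ A₀ →+ A ⧸ A₀ :=
    QuotientAddGroup.map A₀ A₀ (DistribSMul.toAddMonoidHom A s) fun a ha => (hsat s a).2 ha
  have hf : Function.Injective f := by
    refine (injective_iff_map_eq_zero f).2 fun q => ?_
    obtain ⟨a, rfl⟩ := QuotientAddGroup.mk_surjective q
    intro h
    exact (QuotientAddGroup.eq_zero_iff a).2
      ((hsat s a).1 ((QuotientAddGroup.eq_zero_iff (s • a)).1 h))
  obtain ⟨q, hq⟩ := Finite.surjective_of_injective hf (QuotientAddGroup.mk a)
  obtain ⟨b, rfl⟩ := QuotientAddGroup.mk_surjective q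
  have h : -(s • b) + a ∈ A₀ := QuotientAddGroup.eq.1 hq
  exact ⟨_, h, b, by abel⟩

omit [IsLeftCancelSMul S A] in
-- Choose `σ` with the index of `σA + pA` maximal, which is possible since the index of `pA` bounds
-- it. The subgroup `τσA + pA` is contained in `σA + pA`, so the two coincide.
theorem exists_smul_stable (hr : Module.rank ℤ A < Cardinal.aleph0) {p : ℕ} (hp : p ≠ 0) :
    ∃ σ : S, ∀ τ : S, ∀ a : A, ∃ b c : A, σ • a = (τ * σ) • b + p • c := by
  have hfin := finiteIndex_range_nsmul hr hp
  let J : S → AddSubgroup A := fun s =>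
    (DistribSMul.toAddMonoidHom A s).range ⊔ (nsmulAddMonoidHom (α := A) p).range
  have hle : ∀ s, (J s).index ≤ (nsmulAddMonoidHom (α := A) p).range.index := fun s =>
    AddSubgroup.index_antitone le_sup_right
  have hJ : ∀ s, (J s).index ≠ 0 := fun s =>
    (AddSubgroup.finiteIndex_of_le (H := (nsmulAddMonoidHom (α := A) p).range)
      le_sup_right).index_ne_zero
  -- Minimizing `F` maximizes the index; by `hle` the natural subtraction never truncates.
  let F : S → ℕ := fun s => (nsmulAddMonoidHom (α := A) p).range.index - (J s).index
  refine ⟨Function.argmin F, fun τ a => ?_⟩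
  generalize hσ : Function.argmin F = σ
  have hmin : F σ ≤ F (τ * σ) := hσ ▸ Function.argmin_le F _
  have h1 : (J (τ * σ)).index ≤ (J σ).index := by
    have := hle σ
    have := hle (τ * σ)
    simp only [F] at hmin
    omega
  have h2 : J (τ * σ) ≤ J σ := by
    refine sup_le_sup_right ?_ _
    rintro _ ⟨b, rfl⟩
    exact ⟨τ • b, by simp [mul_comm τ σ, mul_smul]⟩
  have h3 := AddSubgroup.relIndex_mul_index h2
  have h4 : (J (τ * σ)).relIndex (J σ) ≤ 1 := by
    by_contra hlt
    nlinarith [Nat.pos_of_ne_zero (hJ σ)]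
  have h5 : (J (τ * σ)).relIndex (J σ) ≠ 0 := fun h0 => hJ (τ * σ) (by rw [← h3, h0, zero_mul])
  have h6 : J σ ≤ J (τ * σ) := AddSubgroup.relIndex_eq_one.1 (by omega)
  have h7 : σ • a ∈ J (τ * σ) := h6 (AddSubgroup.mem_sup_left ⟨a, rfl⟩)
  obtain ⟨_, ⟨b, rfl⟩, _, ⟨c, rfl⟩, h⟩ := AddSubgroup.mem_sup.1 h7
  exact ⟨b, c, h.symm⟩

/-- The difficulty is that `τ` in `hF` depends on the finite set. A single finite `F₀ ⊆ A₀` is found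
with `A = ⟨F₀⟩ + τσA + p ^ k A` for all `τ` and `k`, so `τ` may be chosen after `F₀`. The index of
`τσA` then takes care of the last summand, up to a factor prime to `p`. -/
theorem eq_top_of_saturated_of_prime (hr : Module.rank ℤ A < Cardinal.aleph0)
    (A₀ : AddSubgroup A) (hsat : ∀ (s : S) (a : A), s • a ∈ A₀ ↔ a ∈ A₀)
    {p : ℕ} (hp : p.Prime) (htors : ∀ a : A, p • a ∈ A₀)
    (hF : ∀ F : Finset A, ∃ τ : S, ∀ a : A,
      τ • a ∈ AddSubgroup.closure (F : Set A) → τ • a ∈ A₀) : A₀ = ⊤ := by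
  classical
  have hpA := finiteIndex_range_nsmul hr hp.ne_zero
  have hA₀ : A₀.FiniteIndex :=
    AddSubgroup.finiteIndex_of_le (H := (nsmulAddMonoidHom (α := A) p).range) (by
      rintro _ ⟨a, rfl⟩
      exact htors a)
  obtain ⟨σ, hσ⟩ := exists_smul_stable (S := S) hr hp.ne_zero
  obtain ⟨F₀, hF₀, hF₀'⟩ : ∃ F₀ : Finset A, (F₀ : Set A) ⊆ A₀ ∧ ∀ a : A,
      ∃ f ∈ F₀, ∃ b c : A, a = f + σ • b + p • c := by
    have : Finite (A ⧸ (nsmulAddMonoidHom (α := A) p).range) :=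
      AddSubgroup.finiteIndex_iff_finite_quotient.1 hpA
    have := Fintype.ofFinite (A ⧸ (nsmulAddMonoidHom (α := A) p).range)
    have h1 : ∀ q : A ⧸ (nsmulAddMonoidHom (α := A) p).range, ∃ a₀ ∈ A₀, ∃ b : A,
        q = QuotientAddGroup.mk (a₀ + σ • b) := fun q => by
      obtain ⟨a, rfl⟩ := QuotientAddGroup.mk_surjective q
      obtain ⟨a₀, h, b, rfl⟩ := sup_range_smul_eq_top A₀ hsat σ a
      exact ⟨a₀, h, b, rfl⟩
    choose f hf b hb using h1
    refine ⟨Finset.univ.image f, ?_, fun a => ?_⟩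
    · intro x hx
      obtain ⟨q, -, rfl⟩ := Finset.mem_image.1 hx
      exact hf q
    · obtain ⟨c, hc⟩ := QuotientAddGroup.eq.1 (hb (QuotientAddGroup.mk a)).symm
      refine ⟨_, Finset.mem_image_of_mem f (Finset.mem_univ (QuotientAddGroup.mk a)),
        b (QuotientAddGroup.mk a), c, ?_⟩
      have hc' : p • c = _ := hc
      rw [hc']
      abel
  -- Iterate `A = F₀ + σA + pA`, replacing `σA` by `τσA + pA` each time through the choice of `σ`.
  have hstep : ∀ (τ : S) (k : ℕ) (a : A), ∃ f ∈ AddSubgroup.closure (F₀ : Set A), ∃ b c : A,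
      a = f + (τ * σ) • b + p ^ k • c := by
    intro τ k
    induction k with
    | zero => exact fun a => ⟨0, zero_mem _, 0, a, by simp⟩
    | succ k ih =>
      intro a
      obtain ⟨f, hf, b, c, rfl⟩ := ih a
      obtain ⟨f', hf', b', c', rfl⟩ := hF₀' c
      obtain ⟨b'', c'', h⟩ := hσ τ b'
      refine ⟨f + p ^ k • f', add_mem hf (nsmul_mem (AddSubgroup.subset_closure hf') _),
        b + p ^ k • b'', c' + c'', ?_⟩
      have h2 : (τ * σ) • (p ^ k • b'') = p ^ k • ((τ * σ) • b'') := smul_comm _ _ _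
      rw [h, smul_add (τ * σ), h2, pow_succ]
      simp only [smul_add, mul_smul (p ^ k) p]
      abel
  refine (AddSubgroup.eq_top_iff' _).2 fun a => ?_
  obtain ⟨τ, hτ⟩ := hF (insert a F₀)
  have hfi := finiteIndex_range_smul hr (τ * σ)
  -- With this `k`, multiplication by `n` sends the summand `p ^ k • c` to an index multiple of `c`,
  -- hence into `τσA`.
  obtain ⟨k, n, hn, hkn⟩ := Nat.exists_eq_pow_mul_and_not_dvd hfi.index_ne_zero p hp.ne_one
  obtain ⟨f, hf, b, c, h⟩ := hstep τ k a
  obtain ⟨d, hd⟩ := (DistribSMul.toAddMonoidHom A (τ * σ)).range.nsmul_index_mem c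
  have hd' : (τ * σ) • d = _ := hd
  have h1 : n • (a - f) = τ • (σ • (n • b + d)) := by
    have h3 : (τ * σ) • (n • b) = n • ((τ * σ) • b) := smul_comm _ _ _
    rw [← mul_smul, smul_add, hd', hkn, h3, h, mul_comm (p ^ k), mul_smul n (p ^ k)]
    simp only [smul_add, smul_sub]
    abel
  have h2 : n • (a - f) ∈ AddSubgroup.closure ((insert a F₀ : Finset A) : Set A) := by
    refine nsmul_mem (sub_mem (AddSubgroup.subset_closure (by simp)) ?_) _
    exact AddSubgroup.closure_mono (by simp) hf
  have h3 : n • (a - f) ∈ A₀ := by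
    rw [h1] at h2 ⊢
    exact hτ _ h2
  have h4 : n • a ∈ A₀ := by
    have := add_mem h3 (nsmul_mem ((AddSubgroup.closure_le A₀).2 hF₀ hf) n)
    rwa [← smul_add, sub_add_cancel] at this
  exact A₀.mem_of_coprime_nsmul_mem ((Nat.Prime.coprime_iff_not_dvd hp).2 hn) (htors a) h4

theorem eq_top_of_saturated (hr : Module.rank ℤ A < Cardinal.aleph0)
    (A₀ : AddSubgroup A) (hsat : ∀ (s : S) (a : A), s • a ∈ A₀ ↔ a ∈ A₀)
    (htors : ∀ a : A, ∃ n : ℕ, n ≠ 0 ∧ n • a ∈ A₀)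
    (hF : ∀ F : Finset A, ∃ τ : S, ∀ a : A,
      τ • a ∈ AddSubgroup.closure (F : Set A) → τ • a ∈ A₀) : A₀ = ⊤ := by
  classical
  have hprime : ∀ p : ℕ, p.Prime → ∀ a : A, p • a ∈ A₀ → a ∈ A₀ := by
    intro p hp a ha
    -- `A₁ / A₀` has exponent dividing `p`, and `A₁` inherits all hypotheses, so the prime case
    -- applies inside `A₁`.
    let A₁ : AddSubgroup A := A₀.comap (nsmulAddMonoidHom p)
    have hA₁ : ∀ b : A, b ∈ A₁ ↔ p • b ∈ A₀ := fun b => Iff.rfl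
    have hsat₁ : ∀ (s : S) (b : A), s • b ∈ A₁ ↔ b ∈ A₁ := fun s b => by
      rw [hA₁, hA₁, smul_comm, hsat]
    let _ : DistribMulAction S A₁ :=
      { smul := fun s b => ⟨s • b.1, (hsat₁ s b.1).2 b.2⟩
        one_smul := fun b => Subtype.ext (one_smul S b.1)
        mul_smul := fun s t b => Subtype.ext (mul_smul s t b.1)
        smul_zero := fun s => Subtype.ext (smul_zero s)
        smul_add := fun s b c => Subtype.ext (smul_add s b.1 c.1) }
    have hval : ∀ (s : S) (b : A₁), ((s • b : A₁) : A) = s • (b : A) := fun _ _ => rfl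
    have : IsLeftCancelSMul S A₁ := ⟨fun s b c h => Subtype.ext
      (IsLeftCancelSMul.left_cancel s b.1 c.1 (congrArg Subtype.val h))⟩
    have hr₁ : Module.rank ℤ A₁ < Cardinal.aleph0 :=
      (Submodule.rank_le (AddSubgroup.toIntSubmodule A₁)).trans_lt hr
    have htop : A₀.addSubgroupOf A₁ = ⊤ := by
      refine eq_top_of_saturated_of_prime (S := S) hr₁ _ (fun s b => ?_) hp (fun b => b.2)
        fun F => ?_
      · exact hsat s b.1
      · obtain ⟨τ, hτ⟩ := hF (F.image Subtype.val)
        refine ⟨τ, fun b hb => hτ b.1 ?_⟩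
        have := AddSubgroup.mem_map_of_mem A₁.subtype hb
        rw [AddMonoidHom.map_closure] at this
        rw [Finset.coe_image]
        exact this
    have : (⟨a, ha⟩ : A₁) ∈ A₀.addSubgroupOf A₁ := htop ▸ AddSubgroup.mem_top _
    exact this
  refine (AddSubgroup.eq_top_iff' _).2 fun a => ?_
  obtain ⟨n, hn, ha⟩ := htors a
  induction n using Nat.recOnMul generalizing a with
  | zero => exact absurd rfl hn
  | one => rwa [one_smul] at ha
  | prime p hp => exact hprime p hp a ha
  | mul m n hm hn' =>
    rw [mul_smul] at ha
    exact hn' a (right_ne_zero_of_mul hn) (hm _ (left_ne_zero_of_mul hn) ha)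

end Saturated

/-! ### Locally constant cocycles with values in a semidirect product -/

/-- A cocycle of the translations by `A` and of `S`, evaluated at the points of `A`, with values in
`H`, each of whose values is periodic under the image of some element of `S`. -/
structure AffineCocycle (S A H : Type*) [CommMonoid S] [AddCommGroup A] [DistribMulAction S A]
    [Group H] where
  trans : A → A → H
  scale : S → A → H
  trans_add : ∀ a b x, trans (a + b) x = trans a (b + x) * trans b x
  scale_trans : ∀ s a x, scale s (a + x) * trans a x = trans (s • a) (s • x) * scale s x
  scale_mul : ∀ s t, scale (s * t) 0 = scale s 0 * scale t 0
  eq_zero_of_trans : ∀ a, trans a 0 = 1 → a = 0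
  trans_periodic : ∀ a, ∃ τ : S, ∀ x y, trans a (x + τ • y) = trans a x
  scale_periodic : ∀ s, ∃ τ : S, ∀ x y, scale s (x + τ • y) = scale s x

theorem zsmul_nsmul_nsmul_comm {X : Type*} [AddCommGroup X] (k : ℤ) (l n m : ℕ) (x : X) :
    k • (l * (n * m)) • x = (k * l * m) • n • x := by
  rw [← natCast_zsmul, ← natCast_zsmul, smul_smul, smul_smul]
  congr 1
  push_cast
  ring

namespace AffineCocycle

/-! ### Partial additivity and conjugation by scalings -/

section General

variable {S A H : Type*} [CommMonoid S] [AddCommGroup A] [DistribMulAction S A] [Group H]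
  (c : AffineCocycle S A H)

theorem trans_zero (x : A) : c.trans 0 x = 1 := by
  have h := c.trans_add 0 0 x
  rw [add_zero, zero_add] at h
  exact left_eq_mul.1 h

/-- The translations whose cocycle is periodic under the image of `τ`. -/
def periodic (τ : S) : AddSubgroup A where
  carrier := {a | ∀ x y, c.trans a (x + τ • y) = c.trans a x}
  zero_mem' := fun x y => by rw [trans_zero, trans_zero]
  add_mem' := fun {a b} ha hb x y => by
    rw [trans_add, ← add_assoc, ha, hb, ← trans_add]
  neg_mem' := fun {a} ha x y => by
    have h : ∀ z, c.trans (-a) z = (c.trans a (-a + z))⁻¹ := fun z => by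
      refine eq_inv_of_mul_eq_one_right ?_
      rw [← trans_add, add_neg_cancel, trans_zero]
    rw [h, h, ← add_assoc, ha]

theorem periodic_le_mul (τ σ : S) : c.periodic τ ≤ c.periodic (τ * σ) := fun a ha x y => by
  rw [mul_smul, ha]

theorem exists_mem_periodic (a : A) : ∃ τ, a ∈ c.periodic τ := c.trans_periodic a

theorem exists_closure_le_periodic (F : Finset A) :
    ∃ τ, AddSubgroup.closure (F : Set A) ≤ c.periodic τ := by
  classical
  induction F using Finset.induction_on with
  | empty => exact ⟨1, by simp⟩
  | insert a F _ ih =>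
    obtain ⟨τ, hτ⟩ := ih
    obtain ⟨σ, hσ⟩ := c.exists_mem_periodic a
    refine ⟨τ * σ, (AddSubgroup.closure_le _).2 ?_⟩
    rw [Finset.coe_insert, Set.insert_subset_iff]
    refine ⟨?_, fun b hb => ?_⟩
    · rw [mul_comm]
      exact c.periodic_le_mul σ τ hσ
    · exact c.periodic_le_mul τ σ (hτ (AddSubgroup.subset_closure hb))

/-- On the periodic translations in the image of `τ`, the cocycle is a homomorphism. -/
def localHom (τ : S) :
    Multiplicative ↥(c.periodic τ ⊓ (DistribSMul.toAddMonoidHom A τ).range) →* H where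
  toFun a := c.trans a.toAdd.1 0
  map_one' := c.trans_zero 0
  map_mul' a b := by
    obtain ⟨y, hy⟩ := b.toAdd.2.2
    have h := a.toAdd.2.1 0 y
    have hy' : τ • y = b.toAdd.1 := hy
    rw [hy', zero_add] at h
    change c.trans (a.toAdd.1 + b.toAdd.1) 0 = _
    rw [c.trans_add, add_zero, h]

variable {c}

theorem trans_add_of_mem {τ : S} {a b : A}
    (ha : a ∈ c.periodic τ ⊓ (DistribSMul.toAddMonoidHom A τ).range)
    (hb : b ∈ c.periodic τ ⊓ (DistribSMul.toAddMonoidHom A τ).range) :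
    c.trans (a + b) 0 = c.trans a 0 * c.trans b 0 :=
  map_mul (c.localHom τ) (Multiplicative.ofAdd ⟨a, ha⟩) (Multiplicative.ofAdd ⟨b, hb⟩)

theorem trans_zsmul_of_mem {τ : S} {a : A}
    (ha : a ∈ c.periodic τ ⊓ (DistribSMul.toAddMonoidHom A τ).range) (k : ℤ) :
    c.trans (k • a) 0 = c.trans a 0 ^ k :=
  map_zpow (c.localHom τ) (Multiplicative.ofAdd ⟨a, ha⟩) k

theorem exists_periodic_and_scale (s : S) (F : Finset A) :
    ∃ τ, AddSubgroup.closure (F : Set A) ≤ c.periodic τ ∧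
      ∀ x y, c.scale s (x + τ • y) = c.scale s x := by
  obtain ⟨τ, hτ⟩ := c.exists_closure_le_periodic F
  obtain ⟨σ, hσ⟩ := c.scale_periodic s
  refine ⟨τ * σ, hτ.trans (c.periodic_le_mul τ σ), fun x y => ?_⟩
  rw [mul_comm, mul_smul, hσ]

/-- Periodicity gives `scale s` the same value at `a` and at `0`, so the commutation rule at base
point `0` becomes conjugation. -/
theorem trans_smul_of_mem {s τ : S} (hτ : ∀ x y, c.scale s (x + τ • y) = c.scale s x) {a : A}
    (ha : a ∈ (DistribSMul.toAddMonoidHom A τ).range) :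
    c.trans (s • a) 0 = c.scale s 0 * c.trans a 0 * (c.scale s 0)⁻¹ := by
  obtain ⟨y, rfl⟩ := ha
  have h := c.scale_trans s (τ • y) 0
  have h1 := hτ 0 y
  rw [zero_add] at h1
  rw [add_zero, smul_zero, h1] at h
  exact eq_mul_inv_of_mul_eq h.symm

end General

/-! ### Extraction of an equivariant embedding from a cocycle -/

section Semidirect

variable {S A N K : Type*} [CommMonoid S] [AddCommGroup A] [IsAddTorsionFree A]
  [DistribMulAction S A] [IsLeftCancelSMul S A] [AddCommGroup N] [IsAddTorsionFree N] [CommGroup K]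
  [IsMulTorsionFree K] {θ : K →* MulAut (Multiplicative N)}
  (c : AffineCocycle S A (Multiplicative N ⋊[θ] K))

/-- On the multiples of some multiple of `a`, the cocycle at `0` is given by multiples of `b`. -/
def Rel (a : A) (b : N) : Prop :=
  ∃ n : ℕ, n ≠ 0 ∧ ∀ k : ℤ,
    c.trans (k • n • a) 0 = SemidirectProduct.inl (Multiplicative.ofAdd (k • n • b))

variable {c}

omit [IsAddTorsionFree N] [IsMulTorsionFree K] in
theorem conj_inl (g : Multiplicative N ⋊[θ] K) (b : Multiplicative N) :
    g * SemidirectProduct.inl b * g⁻¹ = SemidirectProduct.inl (θ g.right b) := by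
  ext <;> simp [mul_comm]

omit [IsAddTorsionFree N] [IsMulTorsionFree K] in
theorem eq_inl_of_right_eq_one {g : Multiplicative N ⋊[θ] K} (h : g.right = 1) :
    g = SemidirectProduct.inl g.left := by
  ext <;> simp [h]

omit [IsAddTorsionFree A] [IsLeftCancelSMul S A] [IsAddTorsionFree N] [IsMulTorsionFree K] in
theorem rel_of_mem {τ : S} {a : A}
    (ha : a ∈ c.periodic τ ⊓ (DistribSMul.toAddMonoidHom A τ).range) {b : N}
    (hb : c.trans a 0 = SemidirectProduct.inl (Multiplicative.ofAdd b)) : c.Rel a b := by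
  refine ⟨1, one_ne_zero, fun k => ?_⟩
  rw [one_smul, one_smul, trans_zsmul_of_mem ha, hb, ofAdd_zsmul, map_zpow]

omit [IsAddTorsionFree A] [IsLeftCancelSMul S A] [IsMulTorsionFree K] in
-- Compare both descriptions at the common multiple `m • n • a`, then use that `N` is torsion-free.
theorem Rel.unique {a : A} {b b' : N} (h : c.Rel a b) (h' : c.Rel a b') : b = b' := by
  obtain ⟨n, hn, h⟩ := h
  obtain ⟨m, hm, h'⟩ := h'
  have h1 := h m
  rw [natCast_zsmul, natCast_zsmul, smul_comm, ← natCast_zsmul, h' n, natCast_zsmul,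
    smul_comm] at h1
  have h2 := Multiplicative.ofAdd.injective (SemidirectProduct.inl_injective h1)
  exact (nsmul_right_injective hn (nsmul_right_injective hm h2)).symm

omit [IsAddTorsionFree A] [IsLeftCancelSMul S A] [IsAddTorsionFree N] [IsMulTorsionFree K] in
theorem Rel.neg {a : A} {b : N} (h : c.Rel a b) : c.Rel (-a) (-b) := by
  obtain ⟨n, hn, h⟩ := h
  refine ⟨n, hn, fun k => ?_⟩
  have := h (-k)
  simpa only [neg_smul, smul_neg] using this

omit [IsAddTorsionFree A] [IsLeftCancelSMul S A] [IsAddTorsionFree N] [IsMulTorsionFree K] in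
theorem Rel.zero : c.Rel 0 0 :=
  ⟨1, one_ne_zero, fun k => by simp [trans_zero]⟩

omit [IsLeftCancelSMul S A] [IsAddTorsionFree N] [IsMulTorsionFree K] in
theorem Rel.eq_zero {a : A} (h : c.Rel a 0) : a = 0 := by
  obtain ⟨n, hn, h⟩ := h
  have h1 := h 1
  rw [smul_zero, smul_zero, ofAdd_zero, map_one, one_smul] at h1
  exact (smul_eq_zero.1 (c.eq_zero_of_trans _ h1)).resolve_left hn

variable (hr : Module.rank ℤ A < Cardinal.aleph0)
include hr

theorem exists_nsmul_mem_range (τ : S) :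
    ∃ n : ℕ, n ≠ 0 ∧ ∀ a : A, n • a ∈ (DistribSMul.toAddMonoidHom A τ).range :=
  have := finiteIndex_range_smul hr τ
  ⟨_, this.index_ne_zero, AddSubgroup.nsmul_index_mem _⟩

omit [IsAddTorsionFree N] [IsMulTorsionFree K] in
theorem Rel.add {a a' : A} {b b' : N} (h : c.Rel a b) (h' : c.Rel a' b') :
    c.Rel (a + a') (b + b') := by
  classical
  obtain ⟨n, hn, h⟩ := h
  obtain ⟨m, hm, h'⟩ := h'
  obtain ⟨τ, hτ⟩ := c.exists_closure_le_periodic {a, a'}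
  obtain ⟨l, hl, hlτ⟩ := exists_nsmul_mem_range hr τ
  have ha : a ∈ c.periodic τ := hτ (AddSubgroup.subset_closure (by simp))
  have ha' : a' ∈ c.periodic τ := hτ (AddSubgroup.subset_closure (by simp))
  refine ⟨l * (n * m), by positivity, fun k => ?_⟩
  have key : ∀ x ∈ c.periodic τ, k • (l * (n * m)) • x ∈
      c.periodic τ ⊓ (DistribSMul.toAddMonoidHom A τ).range := fun x hx =>
    zsmul_mem (mul_smul l (n * m) x ▸ ⟨nsmul_mem (nsmul_mem hx _) _, hlτ _⟩) _
  rw [smul_add, smul_add, smul_add, smul_add, trans_add_of_mem (key a ha) (key a' ha'), ofAdd_add,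
    map_mul]
  congr 1
  · rw [zsmul_nsmul_nsmul_comm k l n m a, h, ← zsmul_nsmul_nsmul_comm]
  · rw [mul_comm n m, zsmul_nsmul_nsmul_comm k l m n a', h', ← zsmul_nsmul_nsmul_comm]

omit [IsAddTorsionFree N] [IsMulTorsionFree K] in
-- After multiplication by `l` every element lies in `τA`, where scaling is conjugation, and
-- conjugation acts on `N` through the linear part alone. Both directions together give the
-- saturation needed in `exists_rel`.
theorem rel_smul_iff (s : S) {a : A} {b : N} :
    c.Rel (s • a) (θ (c.scale s 0).right (Multiplicative.ofAdd b)).toAdd ↔ c.Rel a b := by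
  obtain ⟨τ, hτ⟩ := c.scale_periodic s
  obtain ⟨l, hl, hlτ⟩ := exists_nsmul_mem_range hr τ
  have key : ∀ (k : ℤ) (n : ℕ), c.trans (k • (n * l) • s • a) 0 = SemidirectProduct.inl
      (Multiplicative.ofAdd
        (k • (n * l) • (θ (c.scale s 0).right (Multiplicative.ofAdd b)).toAdd)) ↔
      c.trans (k • (n * l) • a) 0 =
        SemidirectProduct.inl (Multiplicative.ofAdd (k • (n * l) • b)) := by
    intro k n
    have h1 : k • (n * l) • s • a = s • (k • (n * l) • a) := by
      rw [smul_comm s k, smul_comm s (n * l)]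
    have h2 : k • (n * l) • a ∈ (DistribSMul.toAddMonoidHom A τ).range := by
      rw [mul_comm, mul_smul]
      exact zsmul_mem (hlτ _) k
    have h3 : Multiplicative.ofAdd
        (k • (n * l) • (θ (c.scale s 0).right (Multiplicative.ofAdd b)).toAdd) =
        θ (c.scale s 0).right (Multiplicative.ofAdd (k • (n * l) • b)) := by
      rw [ofAdd_zsmul, ofAdd_nsmul, ofAdd_zsmul, ofAdd_nsmul, map_zpow, map_pow, ofAdd_toAdd]
    rw [h1, trans_smul_of_mem hτ h2, h3, ← conj_inl, mul_left_inj, mul_right_inj]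
  constructor
  · rintro ⟨n, hn, h⟩
    refine ⟨n * l, mul_ne_zero hn hl, fun k => (key k n).1 ?_⟩
    have := h (k * l)
    rwa [mul_smul, mul_smul, natCast_zsmul, natCast_zsmul, ← mul_smul l, ← mul_smul l,
      mul_comm l] at this
  · rintro ⟨n, hn, h⟩
    refine ⟨n * l, mul_ne_zero hn hl, fun k => (key k n).2 ?_⟩
    have := h (k * l)
    rwa [mul_smul, mul_smul, natCast_zsmul, natCast_zsmul, ← mul_smul l, ← mul_smul l,
      mul_comm l] at this

omit [IsAddTorsionFree N] [IsMulTorsionFree K] in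
theorem exists_rel_nsmul {s : S} (hs : ∀ a : A, s • a = a → a = 0) (a : A) :
    ∃ n : ℕ, n ≠ 0 ∧ ∃ b : N, c.Rel (n • a) b := by
  classical
  let φ : A →+ A := DistribSMul.toAddMonoidHom A s - AddMonoidHom.id A
  have hφ : Function.Injective φ := (injective_iff_map_eq_zero φ).2 fun x hx =>
    hs x (sub_eq_zero.1 hx)
  have hfi := finiteIndex_range_of_injective hr φ hφ
  obtain ⟨x, hx⟩ := φ.range.nsmul_index_mem a
  obtain ⟨τ, hτ, hτ'⟩ := c.exists_periodic_and_scale s {x, s • x}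
  obtain ⟨l, hl, hlτ⟩ := exists_nsmul_mem_range hr τ
  have hx1 : l • x ∈ c.periodic τ ⊓ (DistribSMul.toAddMonoidHom A τ).range :=
    ⟨nsmul_mem (hτ (AddSubgroup.subset_closure (by simp))) _, hlτ x⟩
  have hx2 : l • s • x ∈ c.periodic τ ⊓ (DistribSMul.toAddMonoidHom A τ).range :=
    ⟨nsmul_mem (hτ (AddSubgroup.subset_closure (by simp))) _, hlτ _⟩
  have ha : l • φ.range.index • a = l • s • x - l • x := by
    rw [← hx, ← smul_sub]; rfl
  have ha' := ha ▸ sub_mem hx2 hx1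
  have h1 := trans_add_of_mem ha' hx1
  rw [ha, sub_add_cancel, smul_comm, trans_smul_of_mem hτ' hx1.2] at h1
  -- `h1` expresses the value at the multiple of `a` as a commutator; its component in the abelian
  -- group `K` is trivial.
  have h2 := congrArg SemidirectProduct.right h1
  simp only [SemidirectProduct.mul_right, SemidirectProduct.inv_right] at h2
  rw [mul_inv_cancel_comm, right_eq_mul] at h2
  refine ⟨l * φ.range.index, mul_ne_zero hl hfi.index_ne_zero,
    (c.trans (l • φ.range.index • a) 0).left.toAdd, ?_⟩
  rw [mul_smul]
  refine rel_of_mem ha' ?_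
  rw [ofAdd_toAdd]
  refine eq_inl_of_right_eq_one ?_
  rw [ha, smul_comm]
  exact h2

omit [IsAddTorsionFree N] in
theorem exists_rel {s : S} (hs : ∀ a : A, s • a = a → a = 0) (a : A) : ∃ b : N, c.Rel a b := by
  let A₀ : AddSubgroup A :=
    { carrier := {a | ∃ b : N, c.Rel a b}
      zero_mem' := ⟨0, Rel.zero⟩
      add_mem' := fun ⟨b, h⟩ ⟨b', h'⟩ => ⟨b + b', h.add hr h'⟩
      neg_mem' := fun ⟨b, h⟩ => ⟨-b, h.neg⟩ }
  suffices h : A₀ = ⊤ from (h ▸ AddSubgroup.mem_top a : a ∈ A₀)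
  refine eq_top_of_saturated (S := S) hr A₀ (fun s a => ⟨?_, ?_⟩) (exists_rel_nsmul hr hs) ?_
  · rintro ⟨b, h⟩
    refine ⟨((θ (c.scale s 0).right)⁻¹ (Multiplicative.ofAdd b)).toAdd, ?_⟩
    rw [← rel_smul_iff hr s, ofAdd_toAdd, MulAut.apply_inv_self]
    exact h
  · rintro ⟨b, h⟩
    exact ⟨_, (rel_smul_iff hr s).2 h⟩
  -- On `τA ∩ ⟨F⟩` the cocycle is a homomorphism. Some power of its value at `τ • y` lies in `N`,
  -- and `K` is torsion-free, so the value itself lies in `N`.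
  · intro F
    obtain ⟨τ, hτ⟩ := c.exists_closure_le_periodic F
    refine ⟨τ, fun y hy => ?_⟩
    have hmem : τ • y ∈ c.periodic τ ⊓ (DistribSMul.toAddMonoidHom A τ).range := ⟨hτ hy, y, rfl⟩
    obtain ⟨m, hm, b, n, hn, h⟩ := exists_rel_nsmul (c := c) hr hs (τ • y)
    have h1 := h 1
    have h2 : (1 : ℤ) • n • m • τ • y = ((n * m : ℕ) : ℤ) • τ • y := by
      rw [one_smul, natCast_zsmul, mul_smul]
    rw [h2, trans_zsmul_of_mem hmem, zpow_natCast] at h1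
    have h3 := congrArg SemidirectProduct.rightHom h1
    rw [map_pow, SemidirectProduct.rightHom_inl, pow_eq_one_iff_left (mul_ne_zero hn hm)] at h3
    exact ⟨(c.trans (τ • y) 0).left.toAdd, rel_of_mem hmem (eq_inl_of_right_eq_one h3)⟩

variable (c) in
/-- The linear part of the cocycle of `S` at `0`. -/
def linearPart : S →* K where
  toFun s := (c.scale s 0).right
  map_one' := by
    have h := congrArg SemidirectProduct.right (c.scale_mul 1 1)
    rw [mul_one, SemidirectProduct.mul_right] at h
    exact left_eq_mul.1 h
  map_mul' s t := by rw [c.scale_mul, SemidirectProduct.mul_right]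

theorem exists_equivariant_embedding (c : AffineCocycle S A (Multiplicative N ⋊[θ] K))
    {s : S} (hs : ∀ a : A, s • a = a → a = 0) :
    ∃ (t : S →* K) (ρ : A →+ N), Function.Injective ρ ∧
      ∀ (s : S) (a : A), ρ (s • a) = (θ (t s) (Multiplicative.ofAdd (ρ a))).toAdd := by
  choose ρ hρ using exists_rel (c := c) hr hs
  let ρ' : A →+ N := AddMonoidHom.mk' ρ fun a b => (hρ (a + b)).unique ((hρ a).add hr (hρ b))
  refine ⟨c.linearPart, ρ', (injective_iff_map_eq_zero ρ').2 fun a ha => ?_, fun s a => ?_⟩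
  · have ha' : ρ a = 0 := ha
    exact (ha' ▸ hρ a).eq_zero
  · exact (hρ (s • a)).unique ((rel_smul_iff hr s).2 (hρ a))

end Semidirect

end AffineCocycle

/-! ### Consequences of mixing -/

section Mixing

/-- The inclusion of `ℚ / ℤ` in the circle. -/
noncomputable def ratCircleHom : AddCircle (1 : ℚ) →+ AddCircle (1 : ℝ) :=
  QuotientAddGroup.map _ _ (Rat.castHom ℝ).toAddMonoidHom (by
    rintro _ ⟨n, rfl⟩
    exact ⟨n, by simp⟩)

theorem ratCircleHom_injective : Function.Injective ratCircleHom := by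
  refine (injective_iff_map_eq_zero _).2 fun x hx => ?_
  obtain ⟨q, rfl⟩ := QuotientAddGroup.mk_surjective x
  obtain ⟨n, hn⟩ := (QuotientAddGroup.eq_zero_iff (q : ℝ)).1 hx
  refine (QuotientAddGroup.eq_zero_iff q).2 ⟨n, ?_⟩
  have h : (n : ℝ) = (q : ℝ) := by simpa using hn
  have h' : (n : ℚ) = q := by exact_mod_cast h
  simpa using h'

namespace DiscreteDual

variable (A : Type*) [AddCommGroup A]

instance : Measure.IsHaarMeasure (haar A) := Measure.isHaarMeasure_haarMeasure ⊤

instance : IsProbabilityMeasure (haar A) := ⟨Measure.haarMeasure_self⟩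

variable {A}

theorem continuous_eval (a : DiscreteCopy A) : Continuous fun χ : DiscreteDual A => χ a :=
  (ContinuousEvalConst.continuous_eval_const (F := DiscreteCopy A →ₜ* Circle) a :)

/-- Characters into `ℚ / ℤ` already separate points, and `ℚ / ℤ` embeds in the circle. -/
theorem exists_apply_ne_one {a : A} (ha : a ≠ 0) :
    ∃ χ : DiscreteDual A, χ (Multiplicative.ofAdd a : DiscreteCopy A) ≠ 1 := by
  obtain ⟨c, hc⟩ := CharacterModule.exists_character_apply_ne_zero_of_ne_zero ha
  let f : Multiplicative A →* Circle :=
    { toFun := fun x => AddCircle.toCircle (ratCircleHom (c x.toAdd))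
      map_one' := by simp
      map_mul' := fun x y => by
        rw [toAdd_mul, map_add, map_add, AddCircle.toCircle_add] }
  let χ : DiscreteCopy A →ₜ* Circle :=
    { toMonoidHom := f
      continuous_toFun := continuous_of_discreteTopology }
  refine ⟨χ, fun h => hc (ratCircleHom_injective
    (AddCircle.injective_toCircle one_ne_zero ?_))⟩
  rw [map_zero, AddCircle.toCircle_zero]
  exact h

theorem map_apply (φ : A →+ A) (χ : DiscreteDual A) (a : A) :
    map φ χ (Multiplicative.ofAdd a : DiscreteCopy A) =
      χ (Multiplicative.ofAdd (φ a) : DiscreteCopy A) := rfl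

end DiscreteDual

/-- If `s` fixes `a ≠ 0`, evaluation at `a` is invariant under all powers of `s`, which are distinct
because `S` is torsion-free. Mixing along these powers gives `μ(X) = μ(X)²` for the preimage `X` of
a neighbourhood of `1`; but `X` and the preimage of a disjoint neighbourhood of some `χ(a) ≠ 1` both
have positive measure. -/
theorem IsDualMixing.eq_zero_of_smul_eq {S A : Type*} [CancelCommMonoid S] [IsMulTorsionFree S]
    [AddCommGroup A] [DistribMulAction S A] (hmix : IsDualMixing S A) {s : S} (hs : s ≠ 1) {a : A}
    (ha : s • a = a) : a = 0 := by
  by_contra hne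
  obtain ⟨χ, hχ⟩ := DiscreteDual.exists_apply_ne_one hne
  obtain ⟨U, V, hU, hV, h1, h2, hUV⟩ := t2_separation hχ.symm
  let ev : DiscreteDual A → Circle := fun χ => χ (Multiplicative.ofAdd a : DiscreteCopy A)
  have hev : Continuous ev := DiscreteDual.continuous_eval _
  have hpow : ∀ n : ℕ, s ^ n • a = a := fun n => by
    induction n with
    | zero => rw [pow_zero, one_smul]
    | succ n ih => rw [pow_succ, mul_smul, ha, ih]
  have hinj : Function.Injective fun n : ℕ => s ^ n := by
    refine injective_pow_iff_not_isOfFinOrder.2 fun h => ?_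
    obtain ⟨n, hn, h⟩ := isOfFinOrder_iff_pow_eq_one.1 h
    exact hs ((pow_eq_one_iff_left hn.ne').1 h)
  have hconst : ∀ n : ℕ, ev ⁻¹' U ∩ DiscreteDual.map (DistribSMul.toAddMonoidHom A (s ^ n)) ⁻¹'
      (ev ⁻¹' U) = ev ⁻¹' U := fun n => by
    refine Set.inter_eq_left.2 fun ψ hψ => ?_
    change DiscreteDual.map _ ψ _ ∈ U
    rw [DiscreteDual.map_apply, DistribSMul.toAddMonoidHom_apply, hpow]
    exact hψ
  have hm := (hU.preimage hev).measurableSet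
  have hlim := (hmix _ _ hm hm).comp hinj.tendsto_cofinite
  rw [Nat.cofinite_eq_atTop] at hlim
  have heq : DiscreteDual.haar A (ev ⁻¹' U) =
      DiscreteDual.haar A (ev ⁻¹' U) * DiscreteDual.haar A (ev ⁻¹' U) := by
    refine tendsto_nhds_unique (Tendsto.congr (fun n => ?_) tendsto_const_nhds) hlim
    exact congrArg (DiscreteDual.haar A) (hconst n).symm
  have hpos : DiscreteDual.haar A (ev ⁻¹' U) ≠ 0 :=
    ((hU.preimage hev).measure_pos _ ⟨1, h1⟩).ne'
  have hVpos : DiscreteDual.haar A (ev ⁻¹' V) ≠ 0 :=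
    ((hV.preimage hev).measure_pos _ ⟨χ, h2⟩).ne'
  have hone : DiscreteDual.haar A (ev ⁻¹' U) = 1 :=
    ((ENNReal.mul_eq_left hpos (measure_ne_top _ _)).1 heq.symm)
  have hcompl : ev ⁻¹' V ⊆ (ev ⁻¹' U)ᶜ := fun ψ hψ hψU => Set.disjoint_left.1 hUV hψU hψ
  exact hVpos (measure_mono_null hcompl ((prob_compl_eq_zero_iff hm).2 hone))

end Mixing

/-! ### Compactness of the completion -/

section Compactness

/-- By commutativity of `S`, the images `τA` are cofinal among the constructible subgroups, so they
suffice to describe the topology of the completion. -/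
theorem IsConstructible.exists_smul_mem {S A : Type*} [CommMonoid S] [AddCommGroup A]
    [DistribMulAction S A] {C : AddSubgroup A} (hC : IsConstructible S A C) :
    ∃ τ : S, ∀ a : A, τ • a ∈ C := by
  induction hC with
  | top => exact ⟨1, fun a => AddSubgroup.mem_top _⟩
  | map s C _ ih =>
    obtain ⟨τ, hτ⟩ := ih
    exact ⟨s * τ, fun a => ⟨τ • a, hτ a, (mul_smul s τ a).symm⟩⟩
  | comap s C _ ih =>
    obtain ⟨τ, hτ⟩ := ih
    refine ⟨τ, fun a => ?_⟩
    change s • τ • a ∈ C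
    rw [smul_comm]
    exact hτ _

namespace Completion

variable {S A : Type*} [CommMonoid S] [AddCommGroup A] [DistribMulAction S A]

/-- The image of `A` under `τ`, as a constructible subgroup. -/
def image (τ : S) : ConstructibleSubgroup S A := img τ ⟨⊤, .top⟩

theorem smul_mem_image (τ : S) (a : A) : τ • a ∈ (image τ : ConstructibleSubgroup S A).1 :=
  ⟨a, AddSubgroup.mem_top a, rfl⟩

theorem image_le_of_forall {τ : S} {C : AddSubgroup A} (h : ∀ a : A, τ • a ∈ C) :
    (image τ : ConstructibleSubgroup S A).1 ≤ C := by
  rintro _ ⟨a, -, rfl⟩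
  exact h a

theorem image_mul_le (σ τ : S) : (image (σ * τ) : ConstructibleSubgroup S A).1 ≤ (image σ).1 :=
  image_le_of_forall fun a => by
    rw [mul_smul]
    exact smul_mem_image σ _

theorem val_eq_of_le {x y : Completion S A} {C D : ConstructibleSubgroup S A} (h : C.1 ≤ D.1)
    (hxy : x.1 C = y.1 C) : x.1 D = y.1 D := by
  rw [← x.2 C D h, hxy, y.2 C D h]

theorem of_add_smul_val (τ : S) (x y : A) :
    (of S A (x + τ • y)).1 (image τ) = (of S A x).1 (image τ) := by
  refine QuotientAddGroup.eq.2 ?_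
  have h : -(x + τ • y) + x = τ • (-y) := by rw [smul_neg]; abel
  rw [h]
  exact smul_mem_image τ _

theorem exists_nhds_image {x : Completion S A} {U : Set (Completion S A)} (hU : U ∈ 𝓝 x) :
    ∃ τ : S, {y : Completion S A | y.1 (image τ) = x.1 (image τ)} ⊆ U := by
  have hx : 𝓝 x = ⨅ C : ConstructibleSubgroup S A, 𝓟 {y | y.1 C = x.1 C} := by
    refine (nhds_iInf).trans (iInf_congr fun C => ?_)
    let _ : TopologicalSpace (A ⧸ C.1) := ⊥
    have : DiscreteTopology (A ⧸ C.1) := ⟨rfl⟩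
    refine (nhds_induced _ _).trans ?_
    rw [nhds_discrete, comap_pure]
    rfl
  have hdir : Directed (· ≥ ·) fun C : ConstructibleSubgroup S A =>
      𝓟 {y : Completion S A | y.1 C = x.1 C} := fun C D => by
    obtain ⟨σ, hσ⟩ := C.2.exists_smul_mem
    obtain ⟨τ, hτ⟩ := D.2.exists_smul_mem
    refine ⟨image (σ * τ), principal_mono.2 fun y hy => ?_, principal_mono.2 fun y hy => ?_⟩
    · exact val_eq_of_le ((image_mul_le σ τ).trans (image_le_of_forall hσ)) hy
    · exact val_eq_of_le ((mul_comm σ τ ▸ image_mul_le τ σ).trans (image_le_of_forall hτ)) hy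
  have : Nonempty (ConstructibleSubgroup S A) := ⟨⟨⊤, .top⟩⟩
  rw [hx, mem_iInf_of_directed hdir] at hU
  obtain ⟨C, hC⟩ := hU
  obtain ⟨τ, hτ⟩ := C.2.exists_smul_mem
  exact ⟨τ, fun y hy => hC (val_eq_of_le (image_le_of_forall hτ) hy)⟩

theorem compactSpace (h : ∀ C : ConstructibleSubgroup S A, Finite (A ⧸ C.1)) :
    CompactSpace (Completion S A) := by
  let _ : ∀ C : ConstructibleSubgroup S A, TopologicalSpace (A ⧸ C.1) := fun _ => ⊥
  have : ∀ C : ConstructibleSubgroup S A, DiscreteTopology (A ⧸ C.1) := fun _ => ⟨rfl⟩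
  have hemb : IsClosedEmbedding (fun (x : Completion S A) C => x.1 C) := by
    refine ⟨⟨⟨?_⟩, fun x y hxy => ext fun C => congrFun hxy C⟩, ?_⟩
    · change (⨅ C : ConstructibleSubgroup S A, TopologicalSpace.induced _ ⊥) =
        TopologicalSpace.induced _ (⨅ C, TopologicalSpace.induced _ _)
      rw [induced_iInf]
      exact iInf_congr fun C => (induced_compose (f := fun (x : Completion S A) C => x.1 C)
        (g := fun x => x C)).symm
    · have hr : Set.range (fun (x : Completion S A) C => x.1 C) =
          ⋂ (C : ConstructibleSubgroup S A) (D : ConstructibleSubgroup S A) (h : C.1 ≤ D.1),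
            {x | QuotientAddGroup.map C.1 D.1 (AddMonoidHom.id A) h (x C) = x D} := by
        ext x
        simp only [Set.mem_iInter]
        exact ⟨fun ⟨y, hy⟩ C D h => hy ▸ y.2 C D h, fun hx => ⟨⟨x, hx⟩, rfl⟩⟩
      rw [hr]
      refine isClosed_iInter fun C => isClosed_iInter fun D => isClosed_iInter fun h =>
        isClosed_eq ?_ (continuous_apply D)
      exact continuous_of_discreteTopology.comp (continuous_apply C)
  exact hemb.compactSpace

/-- Each point has its own period; finitely many of the resulting neighbourhoods cover the space,
and the product of their periods works everywhere. -/
theorem exists_period_of_isLocallyConstant [CompactSpace (Completion S A)] {X : Type*}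
    {f : Completion S A → X} (hf : IsLocallyConstant f) :
    ∃ τ : S, ∀ x y : Completion S A, x.1 (image τ) = y.1 (image τ) → f x = f y := by
  classical
  have h1 : ∀ x : Completion S A, ∃ τ : S,
      ∀ y : Completion S A, y.1 (image τ) = x.1 (image τ) → f y = f x := fun x =>
    exists_nhds_image (hf.isOpen_fiber (f x) |>.mem_nhds rfl)
  choose τ hτ using h1
  obtain ⟨t, -, ht⟩ := isCompact_univ.elim_nhds_subcover
    (fun x : Completion S A => {y | y.1 (image (τ x)) = x.1 (image (τ x))})
    fun x _ => (isOpen_coord (image (τ x)) {x.1 (image (τ x))}).mem_nhds rfl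
  refine ⟨∏ x ∈ t, τ x, fun x y hxy => ?_⟩
  obtain ⟨z, hz, hxz⟩ := Set.mem_iUnion₂.1 (ht (Set.mem_univ x))
  have hle : (image (∏ x ∈ t, τ x) : ConstructibleSubgroup S A).1 ≤ (image (τ z)).1 := by
    rw [← Finset.mul_prod_erase _ _ hz]
    exact image_mul_le _ _
  have hyx := val_eq_of_le hle hxy.symm
  rw [hτ z x hxz, hτ z y (hyx.trans hxz)]

theorem compactSpace_of_rank [IsAddTorsionFree A] [IsLeftCancelSMul S A]
    (hr : Module.rank ℤ A < Cardinal.aleph0) : CompactSpace (Completion S A) :=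
  compactSpace fun C => by
    obtain ⟨τ, hτ⟩ := C.2.exists_smul_mem
    have := finiteIndex_range_smul hr τ
    have hle : (DistribSMul.toAddMonoidHom A τ).range ≤ C.1 := by
      rintro _ ⟨a, rfl⟩
      exact hτ a
    exact AddSubgroup.finiteIndex_iff_finite_quotient.1 (AddSubgroup.finiteIndex_of_le hle)

end Completion

end Compactness

/-! ### The cocycle of a groupoid isomorphism -/

section GroupoidCocycle

theorem oreDiv_one_smul_oreDiv_one {S X : Type*} [CommMonoid S] [AddCommGroup X]
    [DistribMulAction S X] (s : S) (x : X) :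
    (s /ₒ 1 : FracGroup S) • (x /ₒ 1 : FracModule S X) = (s • x) /ₒ 1 := by
  rw [OreLocalization.oreDiv_smul_char s x 1 1 s 1 (by simp), mul_one]

theorem eq_zero_of_oreDiv_eq_zero {S X : Type*} [CommMonoid S] [AddCommGroup X]
    [DistribMulAction S X] [IsLeftCancelSMul S X] {x : X} {s : (⊤ : Submonoid S)}
    (h : (x /ₒ s : FracModule S X) = 0) : x = 0 := by
  rw [← OreLocalization.zero_oreDiv s] at h
  obtain ⟨u, v, h1, -⟩ := OreLocalization.oreDiv_eq_iff.1 h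
  rw [smul_zero] at h1
  exact IsLeftCancelSMul.left_cancel v x 0 (by rw [← h1, smul_zero])

namespace AffineGroup

variable (S A : Type*) [CommMonoid S] [AddCommGroup A] [DistribMulAction S A]

variable {A} in
/-- The translation by `a`. -/
noncomputable def translation (a : A) : AffineGroup S A :=
  ⟨Multiplicative.ofAdd (a /ₒ 1), 1⟩

variable {S} in
/-- The multiplication by `s`. -/
noncomputable def scaling (s : S) : AffineGroup S A := ⟨1, s /ₒ 1⟩

variable {S A}

theorem translation_mul (a b : A) :
    translation S a * translation S b = translation S (a + b) := by
  refine SemidirectProduct.ext ?_ (mul_one 1)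
  rw [SemidirectProduct.mul_left]
  change _ * (globalizationHom S A 1) _ = _
  rw [map_one]
  exact congrArg Multiplicative.ofAdd (OreLocalization.add_oreDiv (r := a) (r' := b) (s := 1))

theorem scaling_mul (s t : S) : scaling A s * scaling A t = scaling A (s * t) := by
  refine SemidirectProduct.ext ?_ ?_
  · change 1 * globalizationHom S A _ 1 = 1
    rw [map_one, one_mul]
  · change (s /ₒ 1 : FracGroup S) * (t /ₒ 1) = (s * t) /ₒ 1
    exact (map_mul (Algebra.GrothendieckGroup.of (M := S)) s t).symm

theorem scaling_mul_translation (s : S) (a : A) :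
    scaling A s * translation S a = translation S (s • a) * scaling A s := by
  refine SemidirectProduct.ext ?_ ?_
  · change 1 * globalizationHom S A _ _ = _ * globalizationHom S A 1 1
    rw [map_one, one_mul]
    refine Eq.trans ?_ (mul_one _).symm
    exact congrArg Multiplicative.ofAdd (oreDiv_one_smul_oreDiv_one s a)
  · exact (mul_one _).trans (one_mul _).symm

theorem translation_smul (a : A) (x : Completion S A) :
    translation S a • toFrac S A x = toFrac S A (Completion.of S A a + x) := by
  rw [affineGroup_smul_def]
  change fracOf S A (a /ₒ 1) + (1 : FracGroup S) • _ = _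
  rw [one_smul, fracOf_oreDiv]
  exact OreLocalization.add_oreDiv

theorem scaling_smul (s : S) (x : Completion S A) :
    scaling A s • toFrac S A x = toFrac S A (s • x) := by
  rw [affineGroup_smul_def]
  change fracOf S A 0 + (s /ₒ 1 : FracGroup S) • _ = _
  rw [map_zero, zero_add]
  exact oreDiv_one_smul_oreDiv_one s x

theorem translation_eq_one [IsLeftCancelSMul S A] {a : A} (h : translation S a = 1) : a = 0 :=
  eq_zero_of_oreDiv_eq_zero (congrArg SemidirectProduct.left h)

end AffineGroup

namespace ActionArrow

variable {S A : Type*} [CommMonoid S] [AddCommGroup A] [DistribMulAction S A]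

/-- The arrow at `x` given by the translation by `a`. -/
noncomputable def translation (a : A) (x : Completion S A) : ActionArrow S A :=
  ⟨(AffineGroup.translation S a, x), _, AffineGroup.translation_smul a x⟩

/-- The arrow at `x` given by the multiplication by `s`. -/
noncomputable def scaling (s : S) (x : Completion S A) : ActionArrow S A :=
  ⟨(AffineGroup.scaling A s, x), _, AffineGroup.scaling_smul s x⟩

theorem translation_target [IsLeftCancelSMul S A] (a : A) (x : Completion S A) :
    (translation a x).target = Completion.of S A a + x :=
  target_eq _ (AffineGroup.translation_smul a x)

theorem scaling_target [IsLeftCancelSMul S A] (s : S) (x : Completion S A) :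
    (scaling s x).target = s • x :=
  target_eq _ (AffineGroup.scaling_smul s x)

theorem continuous_translation (a : A) : Continuous (translation (S := S) a) :=
  continuous_iff.2 ⟨IsLocallyConstant.const _, continuous_id⟩

theorem continuous_scaling (s : S) : Continuous (scaling (A := A) s) :=
  continuous_iff.2 ⟨IsLocallyConstant.const _, continuous_id⟩

end ActionArrow

/-! ### From a groupoid isomorphism to a periodic cocycle -/

namespace TopGroupoid.Iso

variable {S A T B : Type*} [CommMonoid S] [AddCommGroup A] [DistribMulAction S A]
  [IsLeftCancelSMul S A] [CommMonoid T] [AddCommGroup B] [DistribMulAction T B]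
  [IsLeftCancelSMul T B] (Φ : TopGroupoid.Iso (actionGroupoid S A) (actionGroupoid T B))

/-- The group component of the image of an arrow. -/
noncomputable def cocycle (α : ActionArrow S A) : AffineGroup T B :=
  Subtype.val (p := fun p : AffineGroup T B × Completion T B =>
    ∃ y, p.1 • toFrac T B p.2 = toFrac T B y) (Φ.arr α) |>.1

theorem cocycle_mul {α β γ : ActionArrow S A} (h : α.1.2 = β.target)
    (h1 : α.1.1 * β.1.1 = γ.1.1) (h2 : β.1.2 = γ.1.2) :
    Φ.cocycle γ = Φ.cocycle α * Φ.cocycle β := by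
  have hγ : γ = (actionGroupoid S A).mul α β h := Subtype.ext (Prod.ext h1.symm h2.symm)
  have := Φ.arr_mul α β h
  rw [← hγ] at this
  rw [cocycle, this]
  rfl

theorem isLocallyConstant_cocycle {Z : Type*} [TopologicalSpace Z] {f : Z → ActionArrow S A}
    (hf : Continuous f) : IsLocallyConstant fun z => Φ.cocycle (f z) :=
  ActionArrow.isLocallyConstant_fst.comp_continuous (Φ.arr.continuous.comp hf)

/-- An arrow is determined by its group component and its source, so the image agrees with that of
the unit at `x`; injectivity on arrows finishes. -/
theorem eq_zero_of_cocycle_translation {a : A} {x : Completion S A}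
    (h : Φ.cocycle (ActionArrow.translation a x) = 1) : a = 0 := by
  have h0 : Φ.cocycle (ActionArrow.translation 0 x) = 1 := by
    have h1 := Φ.cocycle_mul (α := ActionArrow.translation 0 x) (β := ActionArrow.translation 0 x)
      (γ := ActionArrow.translation 0 x)
      (by rw [ActionArrow.translation_target, map_zero, zero_add]; rfl)
      ((AffineGroup.translation_mul 0 0).trans (congrArg _ (add_zero 0))) rfl
    exact left_eq_mul.1 h1
  have h1 : Φ.arr (ActionArrow.translation a x) = Φ.arr (ActionArrow.translation 0 x) := by
    refine Subtype.ext (Prod.ext (h.trans h0.symm) ?_)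
    exact (Φ.source_arr _).trans (Φ.source_arr (ActionArrow.translation 0 x)).symm
  have h2 := congrArg (fun α : ActionArrow S A => α.1.1) (Φ.arr.injective h1)
  have h3 : AffineGroup.translation S a = AffineGroup.translation S 0 := h2
  refine AffineGroup.translation_eq_one (S := S) (h3.trans ?_)
  exact left_eq_mul.1 ((AffineGroup.translation_mul 0 0).trans
    (congrArg (AffineGroup.translation S) (add_zero (0 : A)))).symm

/-- The restriction of the cocycle of an isomorphism to `A`. -/
noncomputable def affineCocycle [CompactSpace (Completion S A)] :
    AffineCocycle S A (AffineGroup T B) where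
  trans a x := Φ.cocycle (ActionArrow.translation a (Completion.of S A x))
  scale s x := Φ.cocycle (ActionArrow.scaling s (Completion.of S A x))
  trans_add a b x := Φ.cocycle_mul
    (by rw [ActionArrow.translation_target, map_add]; rfl) (AffineGroup.translation_mul a b) rfl
  scale_trans s a x := by
    -- This one arrow factors both as `s` after `a` and as `s • a` after `s`.
    let α : ActionArrow S A := (actionGroupoid S A).mul
      (ActionArrow.scaling s (Completion.of S A (a + x)))
      (ActionArrow.translation a (Completion.of S A x))
      (by
        change Completion.of S A (a + x) = ActionArrow.target _
        rw [ActionArrow.translation_target, map_add])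
    refine (Φ.cocycle_mul (γ := α) ?_ rfl rfl).symm.trans (Φ.cocycle_mul (γ := α) ?_ ?_ rfl)
    · rw [ActionArrow.translation_target, map_add]; rfl
    · rw [ActionArrow.scaling_target]; rfl
    · exact (AffineGroup.scaling_mul_translation s a).symm
  scale_mul s t := Φ.cocycle_mul
    (by rw [ActionArrow.scaling_target, map_zero, smul_zero]; rfl) (AffineGroup.scaling_mul s t) rfl
  eq_zero_of_trans _ h := Φ.eq_zero_of_cocycle_translation h
  trans_periodic a := by
    obtain ⟨τ, hτ⟩ := Completion.exists_period_of_isLocallyConstant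
      (Φ.isLocallyConstant_cocycle (ActionArrow.continuous_translation (S := S) a))
    exact ⟨τ, fun x y => hτ _ _ (Completion.of_add_smul_val τ x y)⟩
  scale_periodic s := by
    obtain ⟨τ, hτ⟩ := Completion.exists_period_of_isLocallyConstant
      (Φ.isLocallyConstant_cocycle (ActionArrow.continuous_scaling (A := A) s))
    exact ⟨τ, fun x y => hτ _ _ (Completion.of_add_smul_val τ x y)⟩

/-- The inverse isomorphism. -/
def symm {G H : TopGroupoid} (Φ : TopGroupoid.Iso G H) : TopGroupoid.Iso H G where
  obj := Φ.obj.symm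
  arr := Φ.arr.symm
  source_arr a := by
    rw [Homeomorph.eq_symm_apply, ← Φ.source_arr, Homeomorph.apply_symm_apply]
  range_arr a := by
    rw [Homeomorph.eq_symm_apply, ← Φ.range_arr, Homeomorph.apply_symm_apply]
  arr_mul a b h := by
    rw [Homeomorph.symm_apply_eq, Φ.arr_mul]
    congr 1 <;> rw [Homeomorph.apply_symm_apply]

end TopGroupoid.Iso

end GroupoidCocycle

/-! ### Extension to the globalization -/

section Globalization

/-- The homomorphism `x ↦ x / s`. -/
noncomputable def oreDivHom {S X : Type*} [CommMonoid S] [AddCommGroup X] [DistribMulAction S X]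
    (s : (⊤ : Submonoid S)) : X →+ FracModule S X where
  toFun x := x /ₒ s
  map_zero' := OreLocalization.zero_oreDiv s
  map_add' _ _ := OreLocalization.add_oreDiv.symm

instance {S X : Type*} [CommMonoid S] [AddCommGroup X] [DistribMulAction S X]
    [IsLeftCancelSMul S X] [IsAddTorsionFree X] : IsAddTorsionFree (FracModule S X) where
  nsmul_right_injective n hn := by
    refine (injective_iff_map_eq_zero (nsmulAddMonoidHom (α := FracModule S X) n)).2 fun x hx => ?_
    induction x using OreLocalization.ind with | _ a s
    have h : oreDivHom s (n • a) = 0 := (map_nsmul (oreDivHom s) n a).trans hx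
    have h1 := eq_zero_of_oreDiv_eq_zero h
    rw [(smul_eq_zero.1 h1).resolve_left hn, OreLocalization.zero_oreDiv]

theorem fracGroup_mul_oreDiv {S : Type*} [CommMonoid S] (u : S) (r : (⊤ : Submonoid S)) :
    Algebra.GrothendieckGroup.of (r : S) * (u /ₒ r : FracGroup S) =
      Algebra.GrothendieckGroup.of u := by
  change Localization.mk (r : S) 1 * Localization.mk u r = Localization.mk u 1
  rw [Localization.mk_mul, Localization.mk_eq_mk_iff, Localization.r_iff_exists]
  exact ⟨1, by simp [mul_comm]⟩

instance {S : Type*} [CancelCommMonoid S] [IsMulTorsionFree S] :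
    IsMulTorsionFree (FracGroup S) where
  pow_left_injective n hn := by
    refine (injective_iff_map_eq_one (powMonoidHom (α := FracGroup S) n)).2 fun x hx => ?_
    induction x using OreLocalization.ind with | _ u r
    have h := fracGroup_mul_oreDiv u r
    have h1 := congrArg (· ^ n) h
    have hx' : (u /ₒ r : FracGroup S) ^ n = 1 := hx
    simp only [mul_pow, hx', mul_one, ← map_pow] at h1
    have h2 := Algebra.GrothendieckGroup.of_injective h1
    rw [pow_left_inj hn] at h2
    rw [h2] at h
    exact mul_eq_left.1 h

theorem exists_common_denominator {S X : Type*} [CommMonoid S] [AddCommGroup X]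
    [DistribMulAction S X] (F : Finset (FracModule S X)) :
    ∃ d : (⊤ : Submonoid S), ∀ x ∈ F, ∃ a : X, x = a /ₒ d := by
  classical
  induction F using Finset.induction_on with
  | empty => exact ⟨1, by simp⟩
  | insert x F _ ih =>
    obtain ⟨d, hd⟩ := ih
    induction x using OreLocalization.ind with | _ a s
    refine ⟨d * s, fun y hy => ?_⟩
    rcases Finset.mem_insert.1 hy with rfl | hy
    · exact ⟨(d : S) • a, OreLocalization.expand a s (d : S) trivial⟩
    · obtain ⟨b, rfl⟩ := hd y hy
      refine ⟨(s : S) • b, ?_⟩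
      rw [mul_comm]
      exact OreLocalization.expand b d (s : S) trivial

/-- A finite independent family has a common denominator, so its numerators are independent in `X`.
-/
theorem rank_fracModule_lt {S X : Type*} [CommMonoid S] [AddCommGroup X]
    [DistribMulAction S X] (hr : Module.rank ℤ X < Cardinal.aleph0) :
    Module.rank ℤ (FracModule S X) < Cardinal.aleph0 := by
  obtain ⟨r, hr⟩ := Cardinal.lt_aleph0.1 hr
  refine (rank_le (n := r) fun F hF => ?_).trans_lt (Cardinal.natCast_lt_aleph0)
  obtain ⟨d, hd⟩ := exists_common_denominator F
  choose! f hf using hd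
  have h : LinearIndependent ℤ fun x : F => f x.1 := by
    refine LinearIndependent.of_comp (oreDivHom d).toIntLinearMap ?_
    have h : (oreDivHom d).toIntLinearMap ∘ (fun x : F => f x.1) = fun x : F => x.1 :=
      funext fun x => (hf x.1 x.2).symm
    rw [h]
    exact hF
  have := h.cardinal_lift_le_rank
  rw [hr] at this
  simpa using this

variable {S A K N : Type*} [CommMonoid S] [AddCommGroup A] [DistribMulAction S A]
  [CommGroup K] [AddCommGroup N] [DistribMulAction K N]

/-- The extension of an equivariant homomorphism to the localization. -/
noncomputable def fracLift (t : S →* K) (ρ : A →+ N)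
    (h : ∀ (s : S) (a : A), ρ (s • a) = t s • ρ a) :
    FracModule S A →+ N where
  toFun := OreLocalization.liftExpand (fun a s => (t s)⁻¹ • ρ a) fun a s r hs => by
    change _ = (t (s * r))⁻¹ • ρ (s • a)
    rw [h, smul_smul, map_mul, mul_inv, mul_assoc, mul_comm, mul_assoc, mul_inv_cancel, mul_one]
  map_zero' := by
    rw [OreLocalization.zero_def, OreLocalization.liftExpand_of, map_zero, smul_zero]
  map_add' x y := by
    induction x using OreLocalization.ind with | _ a s
    induction y using OreLocalization.ind with | _ b r
    have hc : ((r : (⊤ : Submonoid S)) : S) * s = (s : S) * r := mul_comm _ _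
    rw [OreLocalization.oreDiv_add_char s r (s : S) r hc, OreLocalization.liftExpand_of,
      OreLocalization.liftExpand_of, OreLocalization.liftExpand_of, map_add, Submonoid.smul_def,
      h, h]
    change (t ((r : S) * s))⁻¹ • _ = _
    rw [map_mul, mul_inv, smul_add, smul_smul, smul_smul]
    congr 2
    · rw [mul_comm, mul_inv_cancel_left]
    · rw [mul_comm (t r)⁻¹, mul_comm, mul_inv_cancel_left]

theorem fracLift_oreDiv {t : S →* K} {ρ : A →+ N} (h : ∀ (s : S) (a : A), ρ (s • a) = t s • ρ a)
    (a : A) (s : (⊤ : Submonoid S)) : fracLift t ρ h (a /ₒ s) = (t s)⁻¹ • ρ a := rfl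

theorem lift_oreDiv (t : S →* K) (u : S) (r : (⊤ : Submonoid S)) :
    Algebra.GrothendieckGroup.lift t (u /ₒ r : FracGroup S) = (t r)⁻¹ * t u := by
  have h := congrArg (Algebra.GrothendieckGroup.lift t) (fracGroup_mul_oreDiv u r)
  rw [map_mul] at h
  have h1 : ∀ s : S, Algebra.GrothendieckGroup.lift t (Algebra.GrothendieckGroup.of s) = t s :=
    DFunLike.congr_fun (Algebra.GrothendieckGroup.lift.symm_apply_apply t)
  rwa [h1, h1, ← eq_inv_mul_iff_mul_eq] at h

theorem fracLift_smul {t : S →* K} {ρ : A →+ N} (h : ∀ (s : S) (a : A), ρ (s • a) = t s • ρ a)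
    (g : FracGroup S) (x : FracModule S A) :
    fracLift t ρ h (g • x) = Algebra.GrothendieckGroup.lift t g • fracLift t ρ h x := by
  induction x using OreLocalization.ind with | _ a s
  induction g using OreLocalization.ind with | _ u r
  rw [OreLocalization.oreDiv_smul_char u a r s u s (mul_comm _ _), fracLift_oreDiv,
    fracLift_oreDiv, lift_oreDiv, h, smul_smul, smul_smul, Submonoid.coe_mul, map_mul, mul_inv]
  congr 1
  rw [mul_right_comm, mul_comm (t s)⁻¹, mul_right_comm, mul_comm (t u)]

theorem fracLift_injective {t : S →* K} {ρ : A →+ N} (hρ : Function.Injective ρ)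
    (h : ∀ (s : S) (a : A), ρ (s • a) = t s • ρ a) : Function.Injective (fracLift t ρ h) := by
  refine (injective_iff_map_eq_zero _).2 fun x hx => ?_
  induction x using OreLocalization.ind with | _ a s
  rw [fracLift_oreDiv, smul_eq_zero_iff_eq, map_eq_zero_iff _ hρ] at hx
  rw [hx, OreLocalization.zero_oreDiv]

/-- If `t r = t u`, then `r` and `u` act equally on `A` since `ρ` is injective, and faithfulness
gives `r = u`. -/
theorem lift_injective [FaithfulSMul S A] {t : S →* K} {ρ : A →+ N} (hρ : Function.Injective ρ)
    (h : ∀ (s : S) (a : A), ρ (s • a) = t s • ρ a) :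
    Function.Injective (Algebra.GrothendieckGroup.lift t) := by
  refine (injective_iff_map_eq_one _).2 fun x hx => ?_
  induction x using OreLocalization.ind with | _ u r
  rw [lift_oreDiv, inv_mul_eq_one] at hx
  have hru : (r : S) = u := FaithfulSMul.eq_of_smul_eq_smul (α := A) fun a => hρ (by rw [h, h, hx])
  have h1 := fracGroup_mul_oreDiv u r
  rw [← hru] at h1 ⊢
  exact mul_eq_left.1 h1

end Globalization

/-! ### The rigidity theorem -/

section Rigidity

theorem TopGroupoid.Iso.exists_embedding {S A T B : Type*}
    [CancelCommMonoid S] [IsMulTorsionFree S]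
    [AddCommGroup A] [IsAddTorsionFree A] (hrankA : Module.rank ℤ A < Cardinal.aleph0)
    [DistribMulAction S A] [IsLeftCancelSMul S A] [FaithfulSMul S A]
    (hA : IsNonAutomorphic S A) (hmixA : IsDualMixing S A)
    [CancelCommMonoid T] [IsMulTorsionFree T] [AddCommGroup B] [IsAddTorsionFree B]
    [DistribMulAction T B] [IsLeftCancelSMul T B]
    (Φ : TopGroupoid.Iso (actionGroupoid S A) (actionGroupoid T B)) :
    ∃ (t : FracGroup S →* FracGroup T) (b : FracModule S A →+ FracModule T B),
      Function.Injective t ∧ Function.Injective b ∧ ∀ g x, b (g • x) = t g • b x := by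
  obtain ⟨s, hs⟩ := hA
  -- Non-automorphy serves to provide a nontrivial element, to which mixing is applied.
  have hs1 : s ≠ 1 := by
    rintro rfl
    exact hs fun a => ⟨a, one_smul S a⟩
  have := Completion.compactSpace_of_rank (S := S) hrankA
  obtain ⟨t, ρ, hρ, h⟩ := Φ.affineCocycle.exists_equivariant_embedding hrankA
    fun a ha => hmixA.eq_zero_of_smul_eq hs1 ha
  have h' : ∀ (s : S) (a : A), ρ (s • a) = t s • ρ a := h
  exact ⟨_, fracLift t ρ h', lift_injective hρ h', fracLift_injective hρ h', fracLift_smul h'⟩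

theorem finiteIndex_range_of_injective_of_injective {M N : Type*} [AddCommGroup M]
    [IsAddTorsionFree M] [AddCommGroup N] (hr : Module.rank ℤ M < Cardinal.aleph0)
    {f : M →+ N} (hf : Function.Injective f) {g : N →+ M} (hg : Function.Injective g) :
    g.range.FiniteIndex := by
  have := finiteIndex_range_of_injective hr (g.comp f) (hg.comp hf)
  refine AddSubgroup.finiteIndex_of_le (H := (g.comp f).range) ?_
  rintro _ ⟨x, rfl⟩
  exact ⟨f x, rfl⟩

theorem mainTheorem5
    (S A T B : Type*)
    [CancelCommMonoid S] [IsMulTorsionFree S]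
    [AddCommGroup A] [IsAddTorsionFree A] (hrankA : Module.rank ℤ A < Cardinal.aleph0)
    [DistribMulAction S A] [IsLeftCancelSMul S A] [FaithfulSMul S A]
    (hA : IsNonAutomorphic S A) (hmixA : IsDualMixing S A)
    [CancelCommMonoid T] [IsMulTorsionFree T]
    [AddCommGroup B] [IsAddTorsionFree B] (hrankB : Module.rank ℤ B < Cardinal.aleph0)
    [DistribMulAction T B] [IsLeftCancelSMul T B] [FaithfulSMul T B]
    (hB : IsNonAutomorphic T B) (hmixB : IsDualMixing T B)
    (hiso : Nonempty (TopGroupoid.Iso (actionGroupoid S A) (actionGroupoid T B))) :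
    FiniteIndexEmbeddable (FracGroup S) (FracModule S A) (FracGroup T) (FracModule T B) ∧
      FiniteIndexEmbeddable (FracGroup T) (FracModule T B) (FracGroup S) (FracModule S A) := by
  obtain ⟨Φ⟩ := hiso
  obtain ⟨t, b, ht, hb, htb⟩ := Φ.exists_embedding hrankA hA hmixA
  obtain ⟨s, a, hs, ha, hsa⟩ := Φ.symm.exists_embedding hrankB hB hmixB
  exact ⟨⟨t, b, ht, hb, htb,
      finiteIndex_range_of_injective_of_injective (rank_fracModule_lt hrankB) ha hb⟩,
    ⟨s, a, hs, ha, hsa,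
      finiteIndex_range_of_injective_of_injective (rank_fracModule_lt hrankA) hb ha⟩⟩

end Rigidity
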